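/- Let $\mathcal M$ be a connected, complete, finite-dimensional smooth Riemannian manifold with Levi-Civita connection $\nabla$ and distance $d$, let $\mathrm R\colon T\mathcal M\to\mathcal M$ be a (smooth) retraction, and let $f\colon\mathcal M\to\mathbb R$, $h\colon\mathcal M\to\mathbb R^l$, $g\colon\mathcal M\to\mathbb R^m$ be smooth. Consider: minimize $f(x)$ over $x\in\mathcal M$ subject to $h(x)=0$, $g(x)\le 0$. Put $\mathcal L(x,y,z)=f(x)+\sum_i y_ih_i(x)+\sum_i z_ig_i(x)$. On the Riemannian product $\mathcal N=\mathcal M\times\mathbb R^l\times\mathbb R^m\times\mathbb R^m$ of points $w=(x,y,z,s)$, with product distance $d$ and product norm on tangent spaces, let $$F(w)=\big(\operatorname{grad}_x\mathcal L(w),\,h(x),\,g(x)+s,\,ZSe\big),\qquad Z=\operatorname{diag}(z),\ S=\operatorname{diag}(s),\ e=(1,\dots,1),$$ be the KKT vector field, with covariant derivative $$\nabla F(w)[\Delta w]=\Big(\operatorname{Hess}_x\mathcal L(w)[\Delta x]+\sum_i\Delta y_i\operatorname{grad}h_i(x)+\sum_i\Delta z_i\operatorname{grad}g_i(x),\ (\langle\operatorname{grad}h_i(x),\Delta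 x\rangle)_i,\ (\langle\operatorname{grad}g_i(x),\Delta x\rangle)_i+\Delta s,\ Z\Delta s+S\Delta z\Big),$$ and let $\hat e=(0_x,0,0,e)$. **Assumptions** at $w^*=(x^*,y^*,z^*,s^*)$: (A1) $\operatorname{grad}_x\mathcal L(x^*,y^*,z^*)=0$, $h(x^*)=0$, $g(x^*)\le0$, $z^*\ge0$, $z_i^*g_i(x^*)=0$ for all $i$, and $s^*=-g(x^*)$; (A2) the vectors $\operatorname{grad}h_i(x^*)$ ($1\le i\le l$) and $\operatorname{grad}g_i(x^*)$ ($g_i(x^*)=0$) are linearly independent; (A3) $z_i^*>0$ whenever $g_i(x^*)=0$; (A4) $\langle\operatorname{Hess}_x\mathcal L(w^*)[\xi],\xi\rangle>0$ for every nonzero $\xi\in T_{x^*}\mathcal M$ orthogonal to all the vectors in (A2). **Algorithm.** Fix $\hat\gamma\in(0,1)$. Start from $w_0\in\mathcal N$ with $(z_0,s_0)>0$ and $\mu_0>0$. At step $k$: solve $\nabla F(w_k)[\Delta w_k]=-F(w_k)+\mu_k\hat e$; choose $\gamma_k\in[\hat\gamma,1]$ and let $$\alpha_k=\min\Big\{1,\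 \gamma_k\min_i\Big\{-\tfrac{(s_k)_i}{(\Delta s_k)_i}\,\Big|\,(\Delta s_k)_i<0\Big\},\ \gamma_k\min_i\Big\{-\tfrac{(z_k)_i}{(\Delta z_k)_i}\,\Big|\,(\Delta z_k)_i<0\Big\}\Big\}$$ (an empty inner minimum is omitted); put $w_{k+1}=\big(\mathrm R_{x_k}(\alpha_k\Delta x_k),\,y_k+\alpha_k\Delta y_k,\,z_k+\alpha_k\Delta z_k,\,s_k+\alpha_k\Delta s_k\big)$; choose $0<\mu_{k+1}<\mu_k$. **Choice of the barrier parameters.** The $\mu_k$ are chosen subject to $\mu_k\le\theta_k(\|F(w_k)\|)$ for all $k$, where $\theta_k\colon\mathbb R\to\mathbb R$, $k\ge 0$, are fixed beforehand and, for each $k$, $\theta_k(t)=O(t)$ as $t\to0$, $t\ge 0$. We say that $\mu_k=o(\|F(w_k)\|)$ if $\theta_k(t)=o(t)$ as $k\to\infty$ and $t\to0$, $t\ge0$, jointly, and that $\mu_k=O(\|F(w_k)\|^2)$ if $\theta_k(t)=O(t^2)$ as $k\to\infty$ and $t\to0$, $t\ge0$, jointly. (For example $\theta_k(t)=\eta_kt$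 with $\eta_k\to0$ in the first case, and $\theta_k(t)=Ct^2$ in the second.) **Theorem.** Let (A1)–(A4) hold at $w^*$, and let $(\theta_k)$ be such that $\mu_k=o(\|F(w_k)\|)$ or $\mu_k=O(\|F(w_k)\|^2)$. Then there is $\delta>0$ such that, for every $w_0$ as above with $d(w_0,w^*)<\delta$ and all admissible choices of the parameters, the sequence $\{w_k\}$ is well defined: whenever $w_0,\dots,w_k$, $\mu_0,\dots,\mu_k$ and $\gamma_0,\dots,\gamma_k$ have been obtained in this way, $\nabla F(w_k)$ is nonsingular, $0<\alpha_k\le1$, and $(z_{k+1},s_{k+1})\ge0$, with strict inequality if $\gamma_k<1$. Furthermore, for every infinite sequence $\{w_k\}$ so generated: 1. if $\mu_k=o(\|F(w_k)\|)$ and $\gamma_k\to1$, then $w_k\to w^*$ superlinearly, that is, $d(w_k,w^*)\to0$ and $d(w_{k+1},w^*)=o(d(w_k,w^*))$; 2. if $\mu_k=O(\|F(w_k)\|^2)$ and $1-\gamma_k=O(\|F(w_k)\|)$, then $w_k\to w^*$ quadratically, that is, $d(w_k,w^*)\to0$ and $d(w_{k+1},w^*)=O(d(w_k,w^*)^2)$.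 -/

import Mathlib

open Bundle Manifold VectorField Filter Asymptotics
open scoped ContDiff Topology

set_option linter.unusedSectionVars false

noncomputable section

namespace RIPM

section LeviCivita

variable {E : Type*} [NormedAddCommGroup E] [NormedSpace ℝ E] [FiniteDimensional ℝ E]
  {M : Type*} [TopologicalSpace M] [ChartedSpace E M] [IsManifold 𝓘(ℝ, E) ∞ M]
  [RiemannianBundle (fun x : M ↦ TangentSpace 𝓘(ℝ, E) x)]

instance finiteDimensional_tangentSpace (x : M) : FiniteDimensional ℝ (TangentSpace 𝓘(ℝ, E) x) :=
  VectorBundle.finiteDimensional ℝ E (TangentSpace 𝓘(ℝ, E) : M → Type _) x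

instance completeSpace_tangentSpace (x : M) : CompleteSpace (TangentSpace 𝓘(ℝ, E) x) :=
  FiniteDimensional.complete ℝ _

/-- The derivative at `x`, in the direction `u`, of the scalar field `⟨X, Y⟩`. -/
def dInner (X Y : Π x : M, TangentSpace 𝓘(ℝ, E) x) (x : M) (u : TangentSpace 𝓘(ℝ, E) x) : ℝ :=
  mvfderiv 𝓘(ℝ, E) (fun p ↦ inner ℝ (X p) (Y p)) x u

/-- The right-hand side of Koszul's formula for `⟨∇_X Y, Z⟩` at `x`. -/
def koszul (X Y Z : Π x : M, TangentSpace 𝓘(ℝ, E) x) (x : M) : ℝ :=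
  (dInner Y Z x (X x) + dInner Z X x (Y x) - dInner X Y x (Z x)
    + inner ℝ (mlieBracket 𝓘(ℝ, E) X Y x) (Z x)
    - inner ℝ (mlieBracket 𝓘(ℝ, E) Y Z x) (X x)
    - inner ℝ (mlieBracket 𝓘(ℝ, E) X Z x) (Y x)) / 2

variable [IsContMDiffRiemannianBundle 𝓘(ℝ, E) ∞ E (fun x : M ↦ TangentSpace 𝓘(ℝ, E) x)]

variable {X X' Y Y' Z Z' : Π x : M, TangentSpace 𝓘(ℝ, E) x} {x : M} {f : M → ℝ}

lemma mdifferentiableAt_inner (hX : MDiffAt (T% X) x) (hY : MDiffAt (T% Y) x) :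
    MDiffAt (fun p ↦ inner ℝ (X p) (Y p)) x :=
  MDifferentiableAt.inner_bundle (E := fun p : M ↦ TangentSpace 𝓘(ℝ, E) p) hX hY

lemma dInner_comm (u : TangentSpace 𝓘(ℝ, E) x) : dInner X Y x u = dInner Y X x u := by
  simp only [dInner, real_inner_comm]

lemma dInner_smul_left (hf : MDiffAt f x) (hX : MDiffAt (T% X) x) (hY : MDiffAt (T% Y) x)
    (u : TangentSpace 𝓘(ℝ, E) x) :
    dInner (f • X) Y x u = f x * dInner X Y x u + mvfderiv 𝓘(ℝ, E) f x u * inner ℝ (X x) (Y x) := by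
  have := mvfderiv_fun_mul hf (mdifferentiableAt_inner hX hY)
  simp only [dInner, Pi.smul_apply', real_inner_smul_left]
  rw [this]
  simp [mul_comm]

lemma dInner_add_left (hX : MDiffAt (T% X) x) (hX' : MDiffAt (T% X') x) (hY : MDiffAt (T% Y) x)
    (u : TangentSpace 𝓘(ℝ, E) x) :
    dInner (X + X') Y x u = dInner X Y x u + dInner X' Y x u := by
  have := mvfderiv_fun_add (mdifferentiableAt_inner hX hY) (mdifferentiableAt_inner hX' hY)
  simp only [dInner, Pi.add_apply, inner_add_left]
  rw [this]
  simp

lemma dInner_smul_right (hf : MDiffAt f x) (hX : MDiffAt (T% X) x) (hY : MDiffAt (T% Y) x)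
    (u : TangentSpace 𝓘(ℝ, E) x) :
    dInner X (f • Y) x u = f x * dInner X Y x u + mvfderiv 𝓘(ℝ, E) f x u * inner ℝ (X x) (Y x) := by
  rw [dInner_comm, dInner_smul_left hf hY hX, dInner_comm, real_inner_comm]

lemma dInner_add_right (hX : MDiffAt (T% X) x) (hY : MDiffAt (T% Y) x) (hY' : MDiffAt (T% Y') x)
    (u : TangentSpace 𝓘(ℝ, E) x) :
    dInner X (Y + Y') x u = dInner X Y x u + dInner X Y' x u := by
  rw [dInner_comm, dInner_add_left hY hY' hX, dInner_comm, dInner_comm (X := Y')]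

lemma dInner_dir_add (u v : TangentSpace 𝓘(ℝ, E) x) :
    dInner X Y x (u + v) = dInner X Y x u + dInner X Y x v := by
  simp [dInner]

lemma dInner_dir_smul (c : ℝ) (u : TangentSpace 𝓘(ℝ, E) x) :
    dInner X Y x (c • u) = c * dInner X Y x u := by
  simp [dInner]

lemma koszul_add_left (hX : MDiffAt (T% X) x) (hX' : MDiffAt (T% X') x) (hY : MDiffAt (T% Y) x)
    (hZ : MDiffAt (T% Z) x) : koszul (X + X') Y Z x = koszul X Y Z x + koszul X' Y Z x := by
  simp only [koszul, dInner_add_left hX hX' hY, dInner_add_right hZ hX hX',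
    mlieBracket_add_left hX hX', Pi.add_apply, dInner_dir_add, inner_add_left, inner_add_right]
  ring

lemma koszul_add_mid (hX : MDiffAt (T% X) x) (hY : MDiffAt (T% Y) x) (hY' : MDiffAt (T% Y') x)
    (hZ : MDiffAt (T% Z) x) : koszul X (Y + Y') Z x = koszul X Y Z x + koszul X Y' Z x := by
  simp only [koszul, dInner_add_left hY hY' hZ, dInner_add_right hX hY hY',
    mlieBracket_add_left hY hY', mlieBracket_add_right hY hY', Pi.add_apply, dInner_dir_add,
    inner_add_left, inner_add_right]
  ring

lemma koszul_add_right (hX : MDiffAt (T% X) x) (hY : MDiffAt (T% Y) x) (hZ : MDiffAt (T% Z) x)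
    (hZ' : MDiffAt (T% Z') x) : koszul X Y (Z + Z') x = koszul X Y Z x + koszul X Y Z' x := by
  simp only [koszul, dInner_add_left hZ hZ' hX, dInner_add_right hY hZ hZ',
    mlieBracket_add_right hZ hZ', Pi.add_apply, dInner_dir_add, inner_add_left, inner_add_right]
  ring

lemma koszul_smul_left (hf : MDiffAt f x) (hX : MDiffAt (T% X) x) (hY : MDiffAt (T% Y) x)
    (hZ : MDiffAt (T% Z) x) : koszul (f • X) Y Z x = f x * koszul X Y Z x := by
  simp only [koszul, dInner_smul_left hf hX hY, dInner_smul_right hf hZ hX,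
    mlieBracket_smul_left hf hX, Pi.smul_apply', dInner_dir_smul, inner_add_left,
    real_inner_smul_left, real_inner_smul_right, neg_smul, inner_neg_left]
  rw [real_inner_comm (X x) (Z x)]
  ring

lemma koszul_smul_right (hf : MDiffAt f x) (hX : MDiffAt (T% X) x) (hY : MDiffAt (T% Y) x)
    (hZ : MDiffAt (T% Z) x) : koszul X Y (f • Z) x = f x * koszul X Y Z x := by
  simp only [koszul, dInner_smul_left hf hZ hX, dInner_smul_right hf hY hZ,
    mlieBracket_smul_right hf hZ, Pi.smul_apply', dInner_dir_smul, inner_add_left,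
    real_inner_smul_left, real_inner_smul_right]
  rw [real_inner_comm (Y x) (Z x)]
  ring

lemma koszul_smul_mid (hf : MDiffAt f x) (hX : MDiffAt (T% X) x) (hY : MDiffAt (T% Y) x)
    (hZ : MDiffAt (T% Z) x) : koszul X (f • Y) Z x =
      f x * koszul X Y Z x + mvfderiv 𝓘(ℝ, E) f x (X x) * inner ℝ (Y x) (Z x) := by
  simp only [koszul, dInner_smul_left hf hY hZ, dInner_smul_right hf hX hY,
    mlieBracket_smul_right hf hY, mlieBracket_smul_left hf hY, Pi.smul_apply', dInner_dir_smul,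
    inner_add_left, real_inner_smul_left, real_inner_smul_right, neg_smul, inner_neg_left]
  rw [real_inner_comm (X x) (Y x)]
  ring

lemma koszul_tensorial_left (hY : MDiffAt (T% Y) x) (hZ : MDiffAt (T% Z) x) :
    TensorialAt 𝓘(ℝ, E) E (fun X : Π p : M, TangentSpace 𝓘(ℝ, E) p ↦ koszul X Y Z x) x where
  smul hf hX := koszul_smul_left hf hX hY hZ
  add hX hX' := koszul_add_left hX hX' hY hZ

lemma koszul_tensorial_right (hX : MDiffAt (T% X) x) (hY : MDiffAt (T% Y) x) :
    TensorialAt 𝓘(ℝ, E) E (fun Z : Π p : M, TangentSpace 𝓘(ℝ, E) p ↦ koszul X Y Z x) x where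
  smul hf hZ := koszul_smul_right hf hX hY hZ
  add hZ hZ' := koszul_add_right hX hY hZ hZ'

/-- The bilinear form `(u, v) ↦ ⟨∇_u Y, v⟩` on `T_x M` given by Koszul's formula. -/
def koszulForm (Y : Π p : M, TangentSpace 𝓘(ℝ, E) p) (x : M) (hY : MDiffAt (T% Y) x) :
    TangentSpace 𝓘(ℝ, E) x →L[ℝ] TangentSpace 𝓘(ℝ, E) x →L[ℝ] ℝ :=
  TensorialAt.mkHom₂ (fun X Z : Π p : M, TangentSpace 𝓘(ℝ, E) p ↦ koszul X Y Z x) x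
    (fun _ hZ ↦ koszul_tensorial_left hY hZ) (fun _ hX ↦ koszul_tensorial_right hX hY)

lemma koszulForm_apply (hX : MDiffAt (T% X) x) (hY : MDiffAt (T% Y) x) (hZ : MDiffAt (T% Z) x) :
    koszulForm Y x hY (X x) (Z x) = koszul X Y Z x :=
  TensorialAt.mkHom₂_apply (Φ := fun X Z : Π p : M, TangentSpace 𝓘(ℝ, E) p ↦ koszul X Y Z x)
    (fun _ hZ ↦ koszul_tensorial_left hY hZ) (fun _ hX ↦ koszul_tensorial_right hX hY) hX hZ

open scoped Classical in
/-- `∇Y(x) : T_x M → T_x M`, `u ↦ ∇_u Y`, for the Levi-Civita connection `∇`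
(with value `0` where `Y` is not differentiable). -/
def leviCivitaFun (Y : Π p : M, TangentSpace 𝓘(ℝ, E) p) (x : M) :
    TangentSpace 𝓘(ℝ, E) x →L[ℝ] TangentSpace 𝓘(ℝ, E) x :=
  if hY : MDiffAt (T% Y) x then
    LinearMap.toContinuousLinearMap
      { toFun := fun u ↦ (InnerProductSpace.toDual ℝ (TangentSpace 𝓘(ℝ, E) x)).symm
          (koszulForm Y x hY u)
        map_add' := by intro u v; simp
        map_smul' := by intro c u; simp }
  else 0

lemma inner_leviCivitaFun (hX : MDiffAt (T% X) x) (hY : MDiffAt (T% Y) x)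
    (hZ : MDiffAt (T% Z) x) :
    inner ℝ (leviCivitaFun Y x (X x)) (Z x) = koszul X Y Z x := by
  rw [← koszulForm_apply hX hY hZ]
  simp [leviCivitaFun, hY]

lemma eq_of_inner_fields {A B : TangentSpace 𝓘(ℝ, E) x →L[ℝ] TangentSpace 𝓘(ℝ, E) x}
    (h : ∀ X Z : Π p : M, TangentSpace 𝓘(ℝ, E) p, MDiffAt (T% X) x → MDiffAt (T% Z) x →
      inner ℝ (A (X x)) (Z x) = inner ℝ (B (X x)) (Z x)) : A = B := by
  ext u
  refine ext_inner_right ℝ fun v ↦ ?_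
  have := h (FiberBundle.extend E u) (FiberBundle.extend E v)
    (FiberBundle.mdifferentiableAt_extend ..) (FiberBundle.mdifferentiableAt_extend ..)
  simpa using this

variable (E M) in
/-- The Levi-Civita connection of the Riemannian manifold `M`. -/
def leviCivita : CovariantDerivative 𝓘(ℝ, E) E (TangentSpace 𝓘(ℝ, E) : M → Type _) where
  toFun := leviCivitaFun
  isCovariantDerivativeOnUniv :=
    { add := fun {Y Y' x} hY hY' _ ↦ by
        refine eq_of_inner_fields fun X Z hX hZ ↦ ?_
        have hs : MDiffAt (T% (Y + Y')) x := mdifferentiableAt_add_section hY hY'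
        rw [inner_leviCivitaFun hX hs hZ, koszul_add_mid hX hY hY' hZ]
        simp [inner_add_left, inner_leviCivitaFun, hX, hY, hY', hZ]
      leibniz := fun {Y g x} hY hg _ ↦ by
        refine eq_of_inner_fields fun X Z hX hZ ↦ ?_
        have hs : MDiffAt (T% (g • Y)) x := hg.smul_section hY
        rw [inner_leviCivitaFun hX hs hZ, koszul_smul_mid hg hX hY hZ]
        simp [inner_add_left, real_inner_smul_left, inner_leviCivitaFun, hX, hY, hZ] }

/-- The Levi-Civita connection is symmetric (torsion-free). -/
theorem leviCivita_torsion : (leviCivita E M).torsion = 0 := by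
  rw [CovariantDerivative.torsion_eq_zero_iff]
  intro X Y x hX hY
  refine ext_inner_right ℝ fun v ↦ ?_
  have hZ := FiberBundle.mdifferentiableAt_extend 𝓘(ℝ, E) E v
  have h1 := inner_leviCivitaFun hX hY hZ
  have h2 := inner_leviCivitaFun hY hX hZ
  rw [FiberBundle.extend_apply_self] at h1 h2
  change inner ℝ (leviCivitaFun Y x (X x) - leviCivitaFun X x (Y x)) v = _
  rw [inner_sub_left, h1, h2]
  simp only [koszul, FiberBundle.extend_apply_self]
  rw [mlieBracket_swap_apply (V := Y) (W := X), inner_neg_left,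
    dInner_comm (X := Y) (Y := X), dInner_comm (X := FiberBundle.extend E v) (Y := X),
    dInner_comm (X := FiberBundle.extend E v) (Y := Y)]
  ring

/-- The Levi-Civita connection is compatible with the metric:
`X⟨Y, Z⟩ = ⟨∇_X Y, Z⟩ + ⟨Y, ∇_X Z⟩`. -/
theorem leviCivita_metric (hX : MDiffAt (T% X) x) (hY : MDiffAt (T% Y) x)
    (hZ : MDiffAt (T% Z) x) :
    mvfderiv 𝓘(ℝ, E) (fun p ↦ inner ℝ (Y p) (Z p)) x (X x) =
      inner ℝ (leviCivita E M Y x (X x)) (Z x) + inner ℝ (Y x) (leviCivita E M Z x (X x)) := by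
  have h1 := inner_leviCivitaFun hX hY hZ
  have h2 := inner_leviCivitaFun hX hZ hY
  change _ = inner ℝ (leviCivitaFun Y x (X x)) (Z x) + inner ℝ (Y x) (leviCivitaFun Z x (X x))
  rw [real_inner_comm (leviCivitaFun Z x (X x)), h1, h2]
  simp only [koszul]
  rw [mlieBracket_swap_apply (V := Z) (W := Y), inner_neg_left,
    dInner_comm (X := Z) (Y := Y), dInner_comm (X := Z) (Y := X), dInner_comm (X := Y) (Y := X)]
  simp only [dInner]
  ring

end LeviCivita

section Problem

variable {E : Type*} [NormedAddCommGroup E] [NormedSpace ℝ E] [FiniteDimensional ℝ E]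
  {M : Type*} [MetricSpace M] [ChartedSpace E M] [IsManifold 𝓘(ℝ, E) ∞ M]
  [RiemannianBundle (fun x : M ↦ TangentSpace 𝓘(ℝ, E) x)]
  [IsContMDiffRiemannianBundle 𝓘(ℝ, E) ∞ E (fun x : M ↦ TangentSpace 𝓘(ℝ, E) x)]
  {l m : ℕ}

/-- The Riemannian gradient: `⟨grad φ(x), ξ⟩ = Dφ(x)[ξ]` for all `ξ ∈ T_x M`. -/
def grad (φ : M → ℝ) (x : M) : TangentSpace 𝓘(ℝ, E) x :=
  (InnerProductSpace.toDual ℝ (TangentSpace 𝓘(ℝ, E) x)).symm (mvfderiv 𝓘(ℝ, E) φ x)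

/-- The Riemannian Hessian `Hess φ(x) = ∇(grad φ)(x)`. -/
def hess (φ : M → ℝ) (x : M) : TangentSpace 𝓘(ℝ, E) x →L[ℝ] TangentSpace 𝓘(ℝ, E) x :=
  leviCivita E M (grad φ) x

variable (E) in
/-- A retraction on `M`: a smooth map `R : TM → M` with `R_x(0_x) = x` and `D R_x(0_x) = id`. -/
structure IsRetraction (R : (x : M) → TangentSpace 𝓘(ℝ, E) x → M) : Prop where
  smooth : ContMDiff 𝓘(ℝ, E).tangent 𝓘(ℝ, E) ∞
    (fun v : TangentBundle 𝓘(ℝ, E) M ↦ R v.proj v.snd)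
  map_zero : ∀ x, R x 0 = x
  hasMFDerivAt_zero : ∀ x, HasMFDerivAt 𝓘(ℝ, E) 𝓘(ℝ, E) (fun v : E ↦ R x v) (0 : E)
    (ContinuousLinearMap.id ℝ E)

variable (E M l m) in
/-- The data of the problem: minimize `f(x)` over `x ∈ M` subject to `h_i(x) = 0` (`i = 1, …, l`)
and `g_i(x) ≤ 0` (`i = 1, …, m`), with smooth `f`, `h`, `g`. -/
structure RCOP where
  f : M → ℝ
  h : Fin l → M → ℝ
  g : Fin m → M → ℝ
  smooth_f : ContMDiff 𝓘(ℝ, E) 𝓘(ℝ, ℝ) ∞ f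
  smooth_h : ∀ i, ContMDiff 𝓘(ℝ, E) 𝓘(ℝ, ℝ) ∞ (h i)
  smooth_g : ∀ i, ContMDiff 𝓘(ℝ, E) 𝓘(ℝ, ℝ) ∞ (g i)

variable (M l m) in
/-- Points `w = (x, y, z, s)` of `N = M × ℝ^l × ℝ^m × ℝ^m`. -/
structure PDPoint where
  x : M
  y : EuclideanSpace ℝ (Fin l)
  z : EuclideanSpace ℝ (Fin m)
  s : EuclideanSpace ℝ (Fin m)

/-- The Riemannian distance of the product manifold `N`. -/
def PDPoint.dist (w w' : PDPoint M l m) : ℝ :=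
  √(Dist.dist w.x w'.x ^ 2 + ‖w.y - w'.y‖ ^ 2 + ‖w.z - w'.z‖ ^ 2 + ‖w.s - w'.s‖ ^ 2)

variable (E) in
/-- The tangent space `T_w N = T_x M × ℝ^l × ℝ^m × ℝ^m`, as a vector space. -/
abbrev PDTangent (w : PDPoint M l m) : Type _ :=
  TangentSpace 𝓘(ℝ, E) w.x × EuclideanSpace ℝ (Fin l) × EuclideanSpace ℝ (Fin m) ×
    EuclideanSpace ℝ (Fin m)

/-- The norm on `T_w N` of the product Riemannian metric. -/
def tangentNorm {w : PDPoint M l m} (ξ : PDTangent E w) : ℝ :=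
  √(‖ξ.1‖ ^ 2 + ‖ξ.2.1‖ ^ 2 + ‖ξ.2.2.1‖ ^ 2 + ‖ξ.2.2.2‖ ^ 2)

/-- The retraction `R̄_w(ξ) = (R_x(ξ_x), y + ξ_y, z + ξ_z, s + ξ_s)` on `N`. -/
def retract (R : (x : M) → TangentSpace 𝓘(ℝ, E) x → M) (w : PDPoint M l m)
    (ξ : PDTangent E w) : PDPoint M l m where
  x := R w.x ξ.1
  y := w.y + ξ.2.1
  z := w.z + ξ.2.2.1
  s := w.s + ξ.2.2.2

namespace RCOP

variable (P : RCOP E M l m)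

/-- The Lagrangian `L(x, y, z)`. -/
def lagrangian (y : EuclideanSpace ℝ (Fin l)) (z : EuclideanSpace ℝ (Fin m)) (x : M) : ℝ :=
  P.f x + ∑ i, y i * P.h i x + ∑ i, z i * P.g i x

/-- `grad_x L(w)`. -/
def gradL (w : PDPoint M l m) : TangentSpace 𝓘(ℝ, E) w.x :=
  grad (P.lagrangian w.y w.z) w.x

/-- `Hess_x L(w)`. -/
def hessL (w : PDPoint M l m) : TangentSpace 𝓘(ℝ, E) w.x →L[ℝ] TangentSpace 𝓘(ℝ, E) w.x :=
  hess (P.lagrangian w.y w.z) w.x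

/-- The KKT vector field `F(w) = (grad_x L(w), h(x), g(x) + s, ZSe)`. -/
def kktField (w : PDPoint M l m) : PDTangent E w :=
  (P.gradL w, WithLp.toLp 2 fun i ↦ P.h i w.x, WithLp.toLp 2 fun i ↦ P.g i w.x + w.s i,
    WithLp.toLp 2 fun i ↦ w.z i * w.s i)

/-- The covariant derivative `∇F(w) : T_w N → T_w N` of the KKT vector field,
`∇F(w)[Δ] = (Hess_x L(w)[Δx] + ∑ Δy_i grad h_i(x) + ∑ Δz_i grad g_i(x),
  (⟨grad h_i(x), Δx⟩)_i, (⟨grad g_i(x), Δx⟩ + Δs_i)_i, ZΔs + SΔz)`. -/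
def covDerivKKT (w : PDPoint M l m) : PDTangent E w →ₗ[ℝ] PDTangent E w where
  toFun Δ :=
    (P.hessL w Δ.1 + ∑ i, Δ.2.1 i • grad (P.h i) w.x + ∑ i, Δ.2.2.1 i • grad (P.g i) w.x,
      WithLp.toLp 2 fun i ↦ inner ℝ (grad (P.h i) w.x) Δ.1,
      WithLp.toLp 2 fun i ↦ inner ℝ (grad (P.g i) w.x) Δ.1 + Δ.2.2.2 i,
      WithLp.toLp 2 fun i ↦ w.z i * Δ.2.2.2 i + w.s i * Δ.2.2.1 i)
  map_add' Δ Δ' := by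
    refine Prod.ext ?_ (Prod.ext ?_ (Prod.ext ?_ ?_))
    · simp only [Prod.fst_add, Prod.snd_add, map_add, PiLp.add_apply, add_smul,
        Finset.sum_add_distrib]
      abel
    · ext i; simp [inner_add_right]
    · ext i; simp [inner_add_right]; ring
    · ext i; simp; ring
  map_smul' c Δ := by
    refine Prod.ext ?_ (Prod.ext ?_ (Prod.ext ?_ ?_))
    · simp [Finset.smul_sum, smul_smul]
    · ext i; simp [real_inner_smul_right]
    · ext i; simp [real_inner_smul_right]; ring
    · ext i; simp; ring

/-- The first-order (KKT) conditions at `w`, with slack `s = -g(x)`; linear independence of the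
gradients of the equality and active inequality constraints; strict complementarity;
second-order sufficiency. -/
structure StandardAssumptions (w : PDPoint M l m) : Prop where
  grad_eq_zero : P.gradL w = 0
  h_eq_zero : ∀ i, P.h i w.x = 0
  g_nonpos : ∀ i, P.g i w.x ≤ 0
  z_nonneg : ∀ i, 0 ≤ w.z i
  complementarity : ∀ i, w.z i * P.g i w.x = 0
  slack : ∀ i, w.s i = -P.g i w.x
  licq : LinearIndependent ℝ (Sum.elim (fun i : Fin l ↦ grad (E := E) (P.h i) w.x)
    (fun i : {i : Fin m // P.g i w.x = 0} ↦ grad (E := E) (P.g i) w.x))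
  strict_complementarity : ∀ i, P.g i w.x = 0 → 0 < w.z i
  second_order : ∀ ξ : TangentSpace 𝓘(ℝ, E) w.x, ξ ≠ 0 →
    (∀ i, inner ℝ ξ (grad (P.h i) w.x) = 0) →
    (∀ i, P.g i w.x = 0 → inner ℝ ξ (grad (P.g i) w.x) = 0) →
    0 < inner ℝ (P.hessL w ξ) ξ

/-- The perturbed Newton equation `∇F(w)[Δ] = -F(w) + μ ê`, where `ê = (0_x, 0, 0, e)`. -/
def NewtonEq (w : PDPoint M l m) (μ : ℝ) (Δ : PDTangent E w) : Prop :=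
  P.covDerivKKT w Δ = -P.kktField w + μ • ((0, 0, 0, WithLp.toLp 2 fun _ ↦ 1) : PDTangent E w)

end RCOP

/-- The fraction-to-boundary step size: the minimum of `1`, of the numbers `γ (-s_i / Δs_i)` over
the `i` with `Δs_i < 0`, and of the numbers `γ (-z_i / Δz_i)` over the `i` with `Δz_i < 0`
(a minimum over a finite nonempty set, as `1` is always present). -/
def stepSize (w : PDPoint M l m) (Δ : PDTangent E w) (γ : ℝ) : ℝ :=
  sInf ({1} ∪ {t | ∃ i, Δ.2.2.2 i < 0 ∧ t = γ * (-w.s i / Δ.2.2.2 i)} ∪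
    {t | ∃ i, Δ.2.2.1 i < 0 ∧ t = γ * (-w.z i / Δ.2.2.1 i)})

namespace RCOP

variable (P : RCOP E M l m)

/-- `w 0, …, w n` are iterates of the prototype interior point method with parameters
`μ 0, …, μ n` and `γ 0, …, γ n` (for `n = ⊤`: the whole sequences). -/
structure IsRun (R : (x : M) → TangentSpace 𝓘(ℝ, E) x → M) (γhat : ℝ)
    (w : ℕ → PDPoint M l m) (μ γ : ℕ → ℝ) (n : ℕ∞) : Prop where
  init_pos : ∀ i, 0 < (w 0).z i ∧ 0 < (w 0).s i
  mu_pos : ∀ k : ℕ, k ≤ n → 0 < μ k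
  mu_lt : ∀ k : ℕ, k < n → μ (k + 1) < μ k
  gamma_mem : ∀ k : ℕ, k ≤ n → γ k ∈ Set.Icc γhat 1
  step : ∀ k : ℕ, k < n → ∃ Δ : PDTangent E (w k), P.NewtonEq (w k) (μ k) Δ ∧
    w (k + 1) = retract R (w k) (stepSize (w k) Δ (γ k) • Δ)

/-- The iteration can be continued from `w` with parameters `μ`, `γ`: `∇F(w)` is nonsingular, so
that the perturbed Newton equation has exactly one solution `Δ`; the step size `α` lies in `(0, 1]`;
and the new `z` and `s` are nonnegative, and positive if `γ < 1`. -/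
def StepWellDefined (w : PDPoint M l m) (μ γ : ℝ) : Prop :=
  Function.Bijective (P.covDerivKKT w) ∧
  ∀ Δ : PDTangent E w, P.NewtonEq w μ Δ →
    0 < stepSize w Δ γ ∧ stepSize w Δ γ ≤ 1 ∧
    (∀ i, 0 ≤ w.z i + stepSize w Δ γ * Δ.2.2.1 i ∧ 0 ≤ w.s i + stepSize w Δ γ * Δ.2.2.2 i) ∧
    (γ < 1 → ∀ i,
      0 < w.z i + stepSize w Δ γ * Δ.2.2.1 i ∧ 0 < w.s i + stepSize w Δ γ * Δ.2.2.2 i)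

end RCOP

/-- `w k → wstar` superlinearly. -/
def ConvergesSuperlinearly (w : ℕ → PDPoint M l m) (wstar : PDPoint M l m) : Prop :=
  Tendsto (fun k ↦ (w k).dist wstar) atTop (𝓝 0) ∧
  (fun k ↦ (w (k + 1)).dist wstar) =o[atTop] fun k ↦ (w k).dist wstar

/-- `w k → wstar` quadratically. -/
def ConvergesQuadratically (w : ℕ → PDPoint M l m) (wstar : PDPoint M l m) : Prop :=
  Tendsto (fun k ↦ (w k).dist wstar) atTop (𝓝 0) ∧
  (fun k ↦ (w (k + 1)).dist wstar) =O[atTop] fun k ↦ (w k).dist wstar ^ 2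

end Problem

end RIPM

end

/-! In a chart around `x*` the method is an inexact Newton iteration in a vector space, and the
proof is a perturbation estimate for one step followed by an induction.

Pairing the KKT field with the coordinate fields turns the Riemannian gradient of the Lagrangian
into its differential, so the field becomes the C² map `kktChart`, free of metric coefficients. Its
Fréchet derivative differs from the covariant derivative by one term, the Christoffel symbols
applied to `grad_x L` (`fderiv_kktChart_sub`). That term vanishes at `w*` and is O(D) near it, where
D is the chart distance to `w*`. Positivity of the Hessian on the critical subspace, linear
independence and strict complementarity make the covariant derivative injective at `w*`, hence
uniformly bounded below nearby. A perturbed Newton step Δ therefore leaves an error O(D² + μ) in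
coordinates (`eventually_newton`).

Two further errors enter. The retraction agrees with translation up to O(|Δ|²), because its
differential at zero is the identity (`IsRetraction.eventually_retract`). The step size satisfies 1
- α ≤ 1 - γ + O(D + μ): in each pair (z_i, s_i) one component stays away from zero, and the
linearized complementarity equation keeps the relative decrease of both components below 1 + O(D +
μ) (`stepSize_spec`). Together these give, in `eventually_step`, D_{k+1} ≤ (1 - γ_k) D_k + C (D_k² +
μ_k).

The rule for the barrier parameters gives a small multiple of D_k as a bound for μ_k only from some
index K on; before K there is just some linear bound. So D may grow by a fixed factor during K
steps, after which it contracts geometrically. Starting close enough to `w*` compensates for the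
growth (`exists_run_bounds`). Convergence is then known, the recursion yields the two rates, and
equivalence of D with the Riemannian distance transfers them. -/

noncomputable section

namespace RIPM

/-! ### Coordinate vector fields of a chart. -/

section ChartCoordinates

variable {E : Type*} [NormedAddCommGroup E] [NormedSpace ℝ E] [FiniteDimensional ℝ E]
  {M : Type*} [TopologicalSpace M] [ChartedSpace E M] [IsManifold 𝓘(ℝ, E) ∞ M]

/-- The coordinates of tangent vectors at `x` in the chart around `p`. -/
def chartCoord (p x : M) : TangentSpace 𝓘(ℝ, E) x →L[ℝ] E :=
  (trivializationAt E (TangentSpace 𝓘(ℝ, E)) p).continuousLinearMapAt ℝ x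

/-- The vector field with constant coordinates `v` in the chart around `p`. -/
def chartField (p : M) (v : E) (x : M) : TangentSpace 𝓘(ℝ, E) x :=
  (trivializationAt E (TangentSpace 𝓘(ℝ, E)) p).symmL ℝ x v

variable {p x : M}

lemma chartCoord_chartField (hx : x ∈ (extChartAt 𝓘(ℝ, E) p).source) (v : E) :
    chartCoord p x (chartField p v x) = v := by
  apply Trivialization.continuousLinearMapAt_symmL
  simpa using hx

lemma chartField_chartCoord (hx : x ∈ (extChartAt 𝓘(ℝ, E) p).source)
    (ξ : TangentSpace 𝓘(ℝ, E) x) : chartField p (chartCoord p x ξ) x = ξ := by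
  apply Trivialization.symmL_continuousLinearMapAt
  simpa using hx

lemma chartField_add (v w : E) : chartField p (v + w) x = chartField p v x + chartField p w x :=
  map_add _ _ _

lemma chartField_smul (c : ℝ) (v : E) : chartField p (c • v) x = c • chartField p v x :=
  map_smul _ _ _

lemma chartCoord_eq_mfderiv (hx : x ∈ (extChartAt 𝓘(ℝ, E) p).source) :
    chartCoord p x = mfderiv 𝓘(ℝ, E) 𝓘(ℝ, E) (extChartAt 𝓘(ℝ, E) p) x :=
  TangentBundle.continuousLinearMapAt_trivializationAt (by simpa using hx)

lemma chartField_eq_mfderiv (hx : x ∈ (extChartAt 𝓘(ℝ, E) p).source) (v : E) :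
    chartField p v x =
      mfderivWithin 𝓘(ℝ, E) 𝓘(ℝ, E) (extChartAt 𝓘(ℝ, E) p).symm (Set.range 𝓘(ℝ, E))
        (extChartAt 𝓘(ℝ, E) p x) v := by
  rw [← TangentBundle.symmL_trivializationAt (by simpa using hx)]
  rfl

lemma contMDiffAt_chartField (hx : x ∈ (extChartAt 𝓘(ℝ, E) p).source) (v : E) :
    ContMDiffAt 𝓘(ℝ, E) 𝓘(ℝ, E).tangent ∞ (T% (chartField p v)) x := by
  have hx' : x ∈ (trivializationAt E (TangentSpace 𝓘(ℝ, E) : M → Type _) p).baseSet := by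
    simpa using hx
  refine ((trivializationAt E (TangentSpace 𝓘(ℝ, E) : M → Type _) p).contMDiffAt_section_iff
    hx').2 ?_
  refine (contMDiffAt_const (c := v)).congr_of_eventuallyEq ?_
  filter_upwards [(trivializationAt E (TangentSpace 𝓘(ℝ, E) : M → Type _) p).open_baseSet.mem_nhds
    hx'] with y hy
  have h := (trivializationAt E (TangentSpace 𝓘(ℝ, E) : M → Type _) p).apply_mk_symm hy v
  rw [← Trivialization.symmL_apply (R := ℝ) _ hy] at h
  exact congr(($h).2)

lemma mdifferentiableAt_chartField (hx : x ∈ (extChartAt 𝓘(ℝ, E) p).source) (v : E) :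
    MDiffAt (T% (chartField p v)) x :=
  (contMDiffAt_chartField hx v).mdifferentiableAt (by simp)

/-- Coordinate fields act as directional derivatives in the chart, by the chain rule for the inverse
chart; the model has no boundary, so derivatives within its range are full derivatives. -/
lemma mvfderiv_chartField {φ : M → ℝ} (hx : x ∈ (extChartAt 𝓘(ℝ, E) p).source)
    (hφ : MDiffAt φ x) (v : E) :
    mvfderiv 𝓘(ℝ, E) φ x (chartField p v x) =
      fderiv ℝ (φ ∘ (extChartAt 𝓘(ℝ, E) p).symm) (extChartAt 𝓘(ℝ, E) p x) v := by
  have h1 := mdifferentiableWithinAt_extChartAt_symm ((extChartAt 𝓘(ℝ, E) p).map_source hx)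
  have h2 := mfderiv_comp_mfderivWithin_of_eq (s := Set.range 𝓘(ℝ, E)) (g := φ) hφ h1
    (by simpa using! uniqueMDiffWithinAt_univ 𝓘(ℝ, E)) ((extChartAt 𝓘(ℝ, E) p).left_inv hx)
  rw [chartField_eq_mfderiv hx, ← fderivWithin_univ, ← mfderivWithin_eq_fderivWithin]
  have h3 : Set.range 𝓘(ℝ, E) = Set.univ := by simp
  rw [h3] at h2 ⊢
  exact congr($h2 v).symm

end ChartCoordinates

/-! ### Comparison of the Riemannian distance with the chart norm. -/

section ChartBounds

variable {E : Type*} [NormedAddCommGroup E] [NormedSpace ℝ E] [FiniteDimensional ℝ E]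
  {M : Type*} [MetricSpace M] [ChartedSpace E M] [IsManifold 𝓘(ℝ, E) ∞ M]
  [RiemannianBundle (fun x : M ↦ TangentSpace 𝓘(ℝ, E) x)]
  [IsContMDiffRiemannianBundle 𝓘(ℝ, E) ∞ E (fun x : M ↦ TangentSpace 𝓘(ℝ, E) x)]

instance isContinuousRiemannianBundle_tangentSpace :
    IsContinuousRiemannianBundle E (fun x : M ↦ TangentSpace 𝓘(ℝ, E) x) := by
  obtain ⟨g, hg, h⟩ := IsContMDiffRiemannianBundle.exists_contMDiff (IB := 𝓘(ℝ, E)) (n := ∞)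
    (F := E) (E := fun x : M ↦ TangentSpace 𝓘(ℝ, E) x)
  exact ⟨g, hg.continuous, h⟩

lemma eventually_norm_chartCoord_le (p : M) :
    ∃ C > 0, ∀ᶠ x in 𝓝 p, ∀ ξ : TangentSpace 𝓘(ℝ, E) x, ‖chartCoord p x ξ‖ ≤ C * ‖ξ‖ := by
  obtain ⟨C, hC, h⟩ :=
    eventually_norm_trivializationAt_lt E (fun x : M ↦ TangentSpace 𝓘(ℝ, E) x) p
  refine ⟨C, hC, h.mono fun x hx ξ ↦ ?_⟩
  exact (ContinuousLinearMap.le_opNorm (E := TangentSpace 𝓘(ℝ, E) x) (chartCoord p x) ξ).trans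
    (by gcongr; exact hx.le)

variable [IsRiemannianManifold 𝓘(ℝ, E) M]

lemma eventually_dist_le_chart (p : M) :
    ∃ C > 0, ∀ᶠ x in 𝓝 p,
      dist x p ≤ C * ‖extChartAt 𝓘(ℝ, E) p x - extChartAt 𝓘(ℝ, E) p p‖ := by
  obtain ⟨C, hC, h⟩ := eventually_riemannianEDist_le_edist_extChartAt 𝓘(ℝ, E) p
  refine ⟨C, hC, h.mono fun x hx ↦ ?_⟩
  rw [← IsRiemannianManifold.out p x, edist_dist, edist_dist, ENNReal.ofReal_eq_coe_nnreal dist_nonneg,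
    ENNReal.ofReal_eq_coe_nnreal dist_nonneg, ← ENNReal.coe_mul, ENNReal.coe_le_coe] at hx
  rw [dist_comm, ← dist_eq_norm, dist_comm (extChartAt _ p x)]
  exact_mod_cast hx

/-- Join `p` to the point by an almost shortest path. It stays where the chart differential is
bounded by `C`, so the length of its image in the chart is at most `C` times its own length. -/
lemma eventually_chart_le_dist (p : M) :
    ∃ C > 0, ∀ᶠ x in 𝓝 p,
      ‖extChartAt 𝓘(ℝ, E) p x - extChartAt 𝓘(ℝ, E) p p‖ ≤ C * dist x p := by
  obtain ⟨C, hC, h⟩ := eventually_norm_chartCoord_le (E := E) p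
  obtain ⟨ε, hε, hball⟩ := Metric.eventually_nhds_iff_ball.1
    (h.and (extChartAt_source_mem_nhds (I := 𝓘(ℝ, E)) p))
  refine ⟨C, hC, Metric.eventually_nhds_iff_ball.2 ⟨ε, hε, fun y hy ↦ ?_⟩⟩
  rw [Metric.mem_ball] at hy
  have key : ∀ b : ℝ, dist y p < b → b < ε →
      ‖extChartAt 𝓘(ℝ, E) p y - extChartAt 𝓘(ℝ, E) p p‖ ≤ C * b := by
    intro b hb hbε
    have hb0 : 0 < b := dist_nonneg.trans_lt hb
    have hlt : riemannianEDist 𝓘(ℝ, E) p y < ENNReal.ofReal b := by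
      rw [← IsRiemannianManifold.out p y, edist_dist, dist_comm]
      exact (ENNReal.ofReal_lt_ofReal_iff hb0).2 hb
    obtain ⟨γ, hγ0, hγ1, hγ, hlen⟩ := exists_lt_of_riemannianEDist_lt hlt
    -- The path cannot leave the ball of radius `ε`: the distance from `p` to `γ t` is at most the
    -- length travelled, which is below `b`.
    have hgood : ∀ t ∈ Set.Icc (0 : ℝ) 1,
        (∀ ξ : TangentSpace 𝓘(ℝ, E) (γ t), ‖chartCoord p (γ t) ξ‖ ≤ C * ‖ξ‖) ∧
          γ t ∈ (extChartAt 𝓘(ℝ, E) p).source := by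
      intro t ht
      refine hball _ ?_
      have h1 : riemannianEDist 𝓘(ℝ, E) p (γ t) ≤ pathELength 𝓘(ℝ, E) γ 0 t :=
        riemannianEDist_le_pathELength (hγ.mono (Set.Icc_subset_Icc le_rfl ht.2)) hγ0 rfl ht.1
      have h2 : pathELength 𝓘(ℝ, E) γ 0 t ≤ pathELength 𝓘(ℝ, E) γ 0 1 :=
        pathELength_mono le_rfl ht.2
      have h3 := (h1.trans h2).trans_lt hlen
      rw [← IsRiemannianManifold.out p (γ t), edist_dist, dist_comm,
        ENNReal.ofReal_lt_ofReal_iff hb0] at h3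
      exact h3.trans hbε
    have hmem : ∀ t ∈ Set.Icc (0 : ℝ) 1, γ t ∈ (chartAt E p).source := fun t ht ↦ by
      simpa using (hgood t ht).2
    have hsm : ContMDiffOn 𝓘(ℝ, ℝ) 𝓘(ℝ, E) 1 (extChartAt 𝓘(ℝ, E) p ∘ γ) (Set.Icc 0 1) :=
      contMDiffOn_extChartAt.comp (I' := 𝓘(ℝ, E)) (t := (chartAt E p).source) hγ hmem
    have hlint : ‖(extChartAt 𝓘(ℝ, E) p ∘ γ) 1 - (extChartAt 𝓘(ℝ, E) p ∘ γ) 0‖ₑ ≤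
        ENNReal.ofReal (C * b) := by
      calc ‖(extChartAt 𝓘(ℝ, E) p ∘ γ) 1 - (extChartAt 𝓘(ℝ, E) p ∘ γ) 0‖ₑ
          ≤ ∫⁻ t in Set.Icc (0 : ℝ) 1,
              ‖derivWithin (extChartAt 𝓘(ℝ, E) p ∘ γ) (Set.Icc 0 1) t‖ₑ :=
            enorm_sub_le_lintegral_derivWithin_Icc_of_contDiffOn_Icc
              (contMDiffOn_iff_contDiffOn.1 hsm) zero_le_one
        _ ≤ ∫⁻ t in Set.Icc (0 : ℝ) 1,
              ENNReal.ofReal C * ‖mfderivWithin 𝓘(ℝ, ℝ) 𝓘(ℝ, E) γ (Set.Icc 0 1) t 1‖ₑ := by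
            refine MeasureTheory.setLIntegral_mono' measurableSet_Icc fun t ht ↦ ?_
            have hu : UniqueMDiffWithinAt 𝓘(ℝ, ℝ) (Set.Icc (0 : ℝ) 1) t := by
              rw [uniqueMDiffWithinAt_iff_uniqueDiffWithinAt]
              exact uniqueDiffOn_Icc zero_lt_one t ht
            have hc := mfderiv_comp_mfderivWithin (s := Set.Icc (0 : ℝ) 1) t
              (mdifferentiableAt_extChartAt (I := 𝓘(ℝ, E)) (hmem t ht))
              (hγ.mdifferentiableOn one_ne_zero t ht) hu
            rw [mfderivWithin_eq_fderivWithin, ← chartCoord_eq_mfderiv (hgood t ht).2] at hc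
            have hd : derivWithin (extChartAt 𝓘(ℝ, E) p ∘ γ) (Set.Icc 0 1) t =
                chartCoord p (γ t) (mfderivWithin 𝓘(ℝ, ℝ) 𝓘(ℝ, E) γ (Set.Icc 0 1) t 1) :=
              congr($hc 1)
            rw [hd, ← ofReal_norm, ← ofReal_norm, ← ENNReal.ofReal_mul hC.le]
            exact ENNReal.ofReal_le_ofReal ((hgood t ht).1 _)
        _ = ENNReal.ofReal C * pathELength 𝓘(ℝ, E) γ 0 1 := by
            rw [MeasureTheory.lintegral_const_mul' _ _ ENNReal.ofReal_ne_top,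
              pathELength_eq_lintegral_mfderivWithin_Icc]
        _ ≤ ENNReal.ofReal C * ENNReal.ofReal b := by gcongr
        _ = ENNReal.ofReal (C * b) := (ENNReal.ofReal_mul hC.le).symm
    rw [← ofReal_norm, ENNReal.ofReal_le_ofReal_iff (by positivity)] at hlint
    simpa [hγ0, hγ1] using hlint
  -- Let `b` decrease to the distance.
  refine ge_of_tendsto (x := 𝓝[>] (dist y p)) (f := fun b ↦ C * b) ?_ ?_
  · exact ((continuous_const.mul continuous_id).tendsto _).mono_left nhdsWithin_le_nhds
  · filter_upwards [Ioo_mem_nhdsGT hy] with b hb using key b hb.1 hb.2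

end ChartBounds

/-! ### Gradient, Hessian and Christoffel symbols in a chart. -/

section Gradient

variable {E : Type*} [NormedAddCommGroup E] [NormedSpace ℝ E] [FiniteDimensional ℝ E]
  {M : Type*} [MetricSpace M] [ChartedSpace E M] [IsManifold 𝓘(ℝ, E) ∞ M]
  [RiemannianBundle (fun x : M ↦ TangentSpace 𝓘(ℝ, E) x)]
  [IsContMDiffRiemannianBundle 𝓘(ℝ, E) ∞ E (fun x : M ↦ TangentSpace 𝓘(ℝ, E) x)]
  {p x : M} {φ : M → ℝ}

lemma contDiffAt_comp_extChartAt_symm {n : ℕ∞ω} (hn : n ≤ ∞) (hx : x ∈ (extChartAt 𝓘(ℝ, E) p).source)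
    (hφ : ContMDiffAt 𝓘(ℝ, E) 𝓘(ℝ, ℝ) n φ x) :
    ContDiffAt ℝ n (φ ∘ (extChartAt 𝓘(ℝ, E) p).symm) (extChartAt 𝓘(ℝ, E) p x) := by
  rw [← contMDiffAt_iff_contDiffAt]
  have h1 : ContMDiffAt 𝓘(ℝ, E) 𝓘(ℝ, E) n (extChartAt 𝓘(ℝ, E) p).symm (extChartAt 𝓘(ℝ, E) p x) :=
    ((contMDiffOn_extChartAt_symm (n := ∞) p).contMDiffAt
      ((isOpen_extChartAt_target p).mem_nhds ((extChartAt 𝓘(ℝ, E) p).map_source hx))).of_le hn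
  exact ContMDiffAt.comp_of_eq hφ h1 ((extChartAt 𝓘(ℝ, E) p).left_inv hx)

lemma inner_grad (φ : M → ℝ) (x : M) (ξ : TangentSpace 𝓘(ℝ, E) x) :
    inner ℝ (grad φ x) ξ = mvfderiv 𝓘(ℝ, E) φ x ξ := by
  simp [grad]

lemma inner_grad_chartField (hφ : ContMDiff 𝓘(ℝ, E) 𝓘(ℝ, ℝ) ∞ φ)
    (hx : x ∈ (extChartAt 𝓘(ℝ, E) p).source) (v : E) :
    inner ℝ (grad φ x) (chartField p v x) =
      fderiv ℝ (φ ∘ (extChartAt 𝓘(ℝ, E) p).symm) (extChartAt 𝓘(ℝ, E) p x) v := by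
  rw [inner_grad, mvfderiv_chartField hx (hφ.mdifferentiable (by simp) x)]

lemma eventually_mem_source (hx : x ∈ (extChartAt 𝓘(ℝ, E) p).source) :
    ∀ᶠ y in 𝓝 x, y ∈ (extChartAt 𝓘(ℝ, E) p).source :=
  (isOpen_extChartAt_source p).mem_nhds hx

/-- The metric in the chart around `p` is given by a smooth family of bilinear forms. -/
lemma exists_metric_in_chart (p : M) : ∃ G : M → E →L[ℝ] E →L[ℝ] ℝ,
    ContMDiffAt 𝓘(ℝ, E) 𝓘(ℝ, E →L[ℝ] E →L[ℝ] ℝ) ∞ G p ∧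
    ∀ x ∈ (extChartAt 𝓘(ℝ, E) p).source, ∀ v w,
      G x v w = inner ℝ (chartField p v x) (chartField p w x) := by
  obtain ⟨g, hg, h⟩ := IsContMDiffRiemannianBundle.exists_contMDiff (IB := 𝓘(ℝ, E)) (n := ∞)
    (F := E) (E := fun x : M ↦ TangentSpace 𝓘(ℝ, E) x)
  refine ⟨_, ((contMDiffAt_hom_bundle _).1 (hg p)).2, fun x hx v w ↦ ?_⟩
  have hx' : x ∈ (trivializationAt E (TangentSpace 𝓘(ℝ, E) : M → Type _) p).baseSet := by
    simpa using hx
  rw [h]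
  refine (inCoordinates_apply_eq₂ (F₃ := ℝ) (E₃ := fun _ : M ↦ ℝ) hx' hx' (Set.mem_univ _)).trans ?_
  simp only [chartField, Trivialization.symmL_apply _ hx']
  simp

/-- In coordinates the gradient is `G⁻¹ dφ`, with `G` the metric matrix. Both factors are smooth,
since inversion of linear maps is smooth at invertible ones. -/
lemma mdifferentiableAt_grad (hφ : ContMDiff 𝓘(ℝ, E) 𝓘(ℝ, ℝ) ∞ φ) (x : M) :
    MDiffAt (T% (grad (E := E) φ)) x := by
  obtain ⟨G, hG, hGi⟩ := exists_metric_in_chart (E := E) x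
  have hx := mem_extChartAt_source (I := 𝓘(ℝ, E)) x
  -- Positive definiteness gives injectivity, and a space and its dual have equal dimension.
  have hinv : ∀ y ∈ (extChartAt 𝓘(ℝ, E) x).source, (G y).IsInvertible := by
    intro y hy
    have hinj : Function.Injective (G y) := by
      rw [injective_iff_map_eq_zero]
      intro v hv
      have h1 := hGi y hy v v
      rw [hv] at h1
      have h2 : chartField x v y = 0 := inner_self_eq_zero.1 h1.symm
      rw [← chartCoord_chartField hy v, h2, map_zero]
    have hfr : Module.finrank ℝ E = Module.finrank ℝ (E →L[ℝ] ℝ) := by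
      rw [← (LinearMap.toContinuousLinearMap (𝕜 := ℝ) (E := E) (F' := ℝ)).finrank_eq]
      exact Subspace.dual_finrank_eq.symm
    exact ⟨(LinearEquiv.ofInjectiveOfFinrankEq (G y : E →ₗ[ℝ] E →L[ℝ] ℝ) hinj
      hfr).toContinuousLinearEquiv, by ext; rfl⟩
  have hx' : x ∈ (trivializationAt E (TangentSpace 𝓘(ℝ, E) : M → Type _) x).baseSet := by
    simp
  refine ((trivializationAt E (TangentSpace 𝓘(ℝ, E) : M → Type _) x).mdifferentiableAt_section_iff
    _ _ hx').2 ?_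
  have hℓ : ContMDiffAt 𝓘(ℝ, E) 𝓘(ℝ, E →L[ℝ] ℝ) ∞
      (fun y ↦ fderiv ℝ (φ ∘ (extChartAt 𝓘(ℝ, E) x).symm) (extChartAt 𝓘(ℝ, E) x y)) x := by
    have h1 := (contDiffAt_comp_extChartAt_symm le_rfl hx (hφ x)).fderiv_right (m := ∞) (by simp)
    exact h1.contMDiffAt.comp x contMDiffAt_extChartAt
  have hI : ContMDiffAt 𝓘(ℝ, E) 𝓘(ℝ, (E →L[ℝ] ℝ) →L[ℝ] E) ∞ (fun y ↦ (G y).inverse) x :=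
    ((hinv x hx).contDiffAt_map_inverse (n := ∞)).contMDiffAt.comp x hG
  refine (MDifferentiableAt.congr_of_eventuallyEq
    ((hI.clm_apply hℓ).mdifferentiableAt (by simp)) ?_)
  filter_upwards [eventually_mem_source hx] with y hy
  have h1 : G y (chartCoord x y (grad φ y)) =
      fderiv ℝ (φ ∘ (extChartAt 𝓘(ℝ, E) x).symm) (extChartAt 𝓘(ℝ, E) x y) := by
    ext v
    rw [hGi y hy, chartField_chartCoord hy, inner_grad_chartField hφ hy]
  have hy' : y ∈ (trivializationAt E (TangentSpace 𝓘(ℝ, E) : M → Type _) x).baseSet := by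
    simpa using hy
  have h2 : chartCoord x y (grad φ y) = (trivializationAt E (TangentSpace 𝓘(ℝ, E)) x ⟨y, grad φ y⟩).2 := by
    rw [chartCoord, Trivialization.continuousLinearMapAt_apply, Trivialization.coe_linearMapAt_of_mem _ hy']
  rw [← h1, ← h2]
  exact ((hinv y hy).inverse_apply_self _).symm

/-- The Hessian in the chart around `p`. -/
lemma inner_hess_chartField (hφ : ContMDiff 𝓘(ℝ, E) 𝓘(ℝ, ℝ) ∞ φ)
    (hx : x ∈ (extChartAt 𝓘(ℝ, E) p).source) (ξ : TangentSpace 𝓘(ℝ, E) x) (v : E) :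
    inner ℝ (hess φ x ξ) (chartField p v x) =
      fderiv ℝ (fderiv ℝ (φ ∘ (extChartAt 𝓘(ℝ, E) p).symm)) (extChartAt 𝓘(ℝ, E) p x)
        (chartCoord p x ξ) v - inner ℝ (grad φ x) (leviCivita E M (chartField p v) x ξ) := by
  -- Metric compatibility applied to `⟨grad φ, ∂_v⟩`: this scalar field is a first partial
  -- derivative of `φ` in the chart, so differentiating it produces the second derivative.
  have h1 := leviCivita_metric (mdifferentiableAt_chartField hx (chartCoord p x ξ))
    (mdifferentiableAt_grad hφ x) (mdifferentiableAt_chartField hx v)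
  rw [chartField_chartCoord hx] at h1
  rw [hess, ← sub_eq_iff_eq_add.2 h1]
  congr 1
  have h2 : MDiffAt (fun q ↦ inner ℝ (grad (E := E) φ q) (chartField p v q)) x :=
    mdifferentiableAt_inner (mdifferentiableAt_grad hφ x) (mdifferentiableAt_chartField hx v)
  have h3 := mvfderiv_chartField hx h2 (chartCoord p x ξ)
  rw [chartField_chartCoord hx] at h3
  rw [h3]
  have h4 := contDiffAt_comp_extChartAt_symm le_rfl hx (hφ x)
  have h5 : DifferentiableAt ℝ (fderiv ℝ (φ ∘ (extChartAt 𝓘(ℝ, E) p).symm))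
      (extChartAt 𝓘(ℝ, E) p x) :=
    (h4.fderiv_right (m := 1) (by norm_cast)).differentiableAt (by simp)
  have h6 : (fun q ↦ inner ℝ (grad (E := E) φ q) (chartField p v q)) ∘ (extChartAt 𝓘(ℝ, E) p).symm
      =ᶠ[𝓝 (extChartAt 𝓘(ℝ, E) p x)]
      fun u ↦ fderiv ℝ (φ ∘ (extChartAt 𝓘(ℝ, E) p).symm) u v := by
    filter_upwards [(isOpen_extChartAt_target p).mem_nhds ((extChartAt 𝓘(ℝ, E) p).map_source hx)]
      with u hu
    rw [Function.comp_apply, inner_grad_chartField hφ ((extChartAt 𝓘(ℝ, E) p).map_target hu),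
      (extChartAt 𝓘(ℝ, E) p).right_inv hu]
  rw [h6.fderiv_eq, fderiv_clm_apply h5 (differentiableAt_const v)]
  simp

lemma continuousAt_dInner_chartField (p : M) (a b c : E) :
    ContinuousAt (fun x ↦ dInner (chartField p a) (chartField p b) x (chartField p c x)) p := by
  have hp := mem_extChartAt_source (I := 𝓘(ℝ, E)) p
  have h1 : ContMDiffAt 𝓘(ℝ, E) 𝓘(ℝ, ℝ) ∞
      (fun q : M ↦ (inner ℝ (chartField p a q) (chartField p b q) : ℝ)) p :=
    ContMDiffAt.inner_bundle (E := fun p : M ↦ TangentSpace 𝓘(ℝ, E) p)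
      (contMDiffAt_chartField hp a) (contMDiffAt_chartField hp b)
  have h2 := (contDiffAt_comp_extChartAt_symm le_rfl hp h1).continuousAt_fderiv (by simp)
  have h3 := (h2.comp (continuousAt_extChartAt (I := 𝓘(ℝ, E)) p)).clm_apply (continuousAt_const (y := c))
  refine h3.congr ?_
  filter_upwards [eventually_mem_source hp] with x hx
  rw [dInner, mvfderiv_chartField hx
    (mdifferentiableAt_inner (mdifferentiableAt_chartField hx a) (mdifferentiableAt_chartField hx b))]
  rfl

/-- Smoothness of the bracket is enough for the Koszul terms; that coordinate fields commute need
not be used. -/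
lemma continuousAt_inner_mlieBracket_chartField (p : M) (a b c : E) :
    ContinuousAt (fun x ↦ (inner ℝ (mlieBracket 𝓘(ℝ, E) (chartField p a) (chartField p b) x)
      (chartField p c x) : ℝ)) p := by
  have hp := mem_extChartAt_source (I := 𝓘(ℝ, E)) p
  have : IsManifold 𝓘(ℝ, E) ((2 : ℕ∞) + 1 : ℕ∞ω) M :=
    .of_le (n := ∞) (by norm_cast)
  have : IsManifold 𝓘(ℝ, E) (minSmoothness ℝ 2) M :=
    .of_le (n := ∞) (by simpa using ENat.LEInfty.out)
  have : IsManifold 𝓘(ℝ, E) (minSmoothness ℝ 3) M :=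
    .of_le (n := ∞) (by simpa using ENat.LEInfty.out)
  have h1 : ContMDiffAt 𝓘(ℝ, E) 𝓘(ℝ, E).tangent (1 : ℕ∞)
      (T% (mlieBracket 𝓘(ℝ, E) (chartField p a) (chartField p b))) p :=
    ContMDiffAt.mlieBracket_vectorField (n := 2)
      ((contMDiffAt_chartField hp a).of_le ENat.LEInfty.out)
      ((contMDiffAt_chartField hp b).of_le ENat.LEInfty.out)
      (by rw [minSmoothness_of_isRCLikeNormedField]; norm_num)
  have h2 := (contMDiffAt_chartField hp c).of_le (n := ∞) (m := ((1 : ℕ∞) : ℕ∞ω)) (by simp)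
  have h3 : ContMDiffAt 𝓘(ℝ, E) 𝓘(ℝ, ℝ) ((1 : ℕ∞) : ℕ∞ω) (fun x : M ↦ (inner ℝ
      (mlieBracket 𝓘(ℝ, E) (chartField p a) (chartField p b) x) (chartField p c x) : ℝ)) p :=
    ContMDiffAt.inner_bundle (E := fun p : M ↦ TangentSpace 𝓘(ℝ, E) p) h1 h2
  exact h3.continuousAt

/-- The Christoffel symbols (of the first kind) of the chart around `p` are bounded near `p`. -/
lemma eventually_abs_inner_leviCivita_le (p : M) (a b c : E) :
    ∃ C > 0, ∀ᶠ x in 𝓝 p,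
      |inner ℝ (leviCivita E M (chartField p b) x (chartField p a x)) (chartField p c x)| ≤ C := by
  have hp := mem_extChartAt_source (I := 𝓘(ℝ, E)) p
  have h : ContinuousAt (koszul (chartField p a) (chartField p b) (chartField p c)) p := by
    unfold koszul
    exact ((((((continuousAt_dInner_chartField p b c a).add
      (continuousAt_dInner_chartField p c a b)).sub
      (continuousAt_dInner_chartField p a b c)).add
      (continuousAt_inner_mlieBracket_chartField p a b c)).sub
      (continuousAt_inner_mlieBracket_chartField p b c a)).sub
      (continuousAt_inner_mlieBracket_chartField p a c b)).div_const 2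
  refine ⟨|koszul (chartField p a) (chartField p b) (chartField p c) p| + 1, by positivity, ?_⟩
  filter_upwards [eventually_mem_source hp, h.abs.eventually_lt continuousAt_const (lt_add_one _)]
    with x hx hlt
  have h1 := inner_leviCivitaFun (mdifferentiableAt_chartField hx a)
    (mdifferentiableAt_chartField hx b) (mdifferentiableAt_chartField hx c)
  exact (congrArg abs h1).trans_le hlt.le

end Gradient

/-! ### Taylor estimates and finite-dimensional linear bounds. -/

section Analysis

variable {E : Type*} [NormedAddCommGroup E] [NormedSpace ℝ E]
  {F : Type*} [NormedAddCommGroup F] [NormedSpace ℝ F]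

/-- Second-order Taylor estimate, locally uniform in the base point. -/
lemma _root_.ContDiffAt.exists_quadratic_bound {f : E → F} {a : E} (hf : ContDiffAt ℝ 2 f a) :
    ∃ C > 0, ∃ r > 0, ∀ x ∈ Metric.ball a r, ∀ y ∈ Metric.ball a r,
      ‖f y - f x - fderiv ℝ f x (y - x)‖ ≤ C * ‖y - x‖ ^ 2 ∧
      ‖fderiv ℝ f y - fderiv ℝ f x‖ ≤ C * ‖y - x‖ := by
  -- The derivative is C¹, hence Lipschitz near `a`; the mean value inequality on segments then
  -- gives the quadratic remainder.
  obtain ⟨K, t, ht, hK⟩ := (hf.fderiv_right (m := 1) (by norm_num)).exists_lipschitzOnWith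
  have hd : ∀ᶠ x in 𝓝 a, DifferentiableAt ℝ f x :=
    (hf.eventually (by simp)).mono fun x hx ↦ hx.differentiableAt (by simp)
  obtain ⟨r, hr, hball⟩ := Metric.mem_nhds_iff.1 (inter_mem ht hd)
  refine ⟨K + 1, by positivity, r, hr, fun x hx y hy ↦ ?_⟩
  have hlip : ∀ z ∈ Metric.ball a r, ‖fderiv ℝ f z - fderiv ℝ f x‖ ≤ (K + 1) * ‖z - x‖ := by
    intro z hz
    refine (hK.norm_sub_le (hball hz).1 (hball hx).1).trans ?_
    gcongr
    simp
  refine ⟨?_, hlip y hy⟩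
  have hseg : segment ℝ x y ⊆ Metric.ball a r := (convex_ball a r).segment_subset hx hy
  rw [pow_two, ← mul_assoc]
  refine (convex_segment x y).norm_image_sub_le_of_norm_fderiv_le'
    (fun z hz ↦ (hball (hseg hz)).2) (fun z hz ↦ (hlip z (hseg hz)).trans ?_)
    (left_mem_segment ℝ x y) (right_mem_segment ℝ x y)
  gcongr
  exact norm_sub_le_of_mem_segment hz

/-- The constant depends on the basis only, not on the form. This makes the Christoffel bound
uniform in the base point. -/
lemma _root_.Module.Basis.exists_bilinear_bound {ι : Type*} [Finite ι] [FiniteDimensional ℝ E]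
    (b : Module.Basis ι ℝ E) :
    ∃ C > (0 : ℝ), ∀ (T : E →ₗ[ℝ] E →ₗ[ℝ] ℝ) (K : ℝ), 0 ≤ K → (∀ i j, |T (b i) (b j)| ≤ K) →
      ∀ u v, |T u v| ≤ C * K * ‖u‖ * ‖v‖ := by
  obtain ⟨C₁, hC₁, h₁⟩ := b.exists_opNorm_le (F := ℝ)
  obtain ⟨C₂, hC₂, h₂⟩ := b.exists_opNorm_le (F := E →L[ℝ] ℝ)
  refine ⟨C₂ * C₁, by positivity, fun T K hK hT u v ↦ ?_⟩
  have h3 : ‖T.toContinuousBilinearMap‖ ≤ C₂ * (C₁ * K) :=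
    h₂ (by positivity) fun i ↦ h₁ hK fun j ↦ hT i j
  have h4 := T.toContinuousBilinearMap.le_opNorm₂ u v
  rw [LinearMap.toContinuousBilinearMap_apply, Real.norm_eq_abs] at h4
  refine h4.trans ?_
  rw [mul_assoc C₂]
  gcongr

lemma _root_.LinearMap.exists_pos_mul_norm_le [FiniteDimensional ℝ E] (A : E →ₗ[ℝ] F)
    (hA : Function.Injective A) : ∃ c > 0, ∀ v, c * ‖v‖ ≤ ‖A v‖ := by
  obtain ⟨K, hK, h⟩ := A.exists_antilipschitzWith (LinearMap.ker_eq_bot.2 hA)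
  refine ⟨(K : ℝ)⁻¹, by positivity, fun v ↦ ?_⟩
  rw [inv_mul_le_iff₀ (by positivity)]
  simpa using h.le_mul_norm_sub v 0

end Analysis

/-! ### The fraction-to-boundary step size. -/

section StepSize

variable {E : Type*} [NormedAddCommGroup E] [NormedSpace ℝ E] [FiniteDimensional ℝ E]
  {M : Type*} [MetricSpace M] [ChartedSpace E M] [IsManifold 𝓘(ℝ, E) ∞ M]
  {l m : ℕ} (w : PDPoint M l m) (Δ : PDTangent E w) (γ : ℝ)

/-- The candidates for the fraction-to-boundary step size. -/
def stepCandidates : Set ℝ :=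
  {1} ∪ {t | ∃ i, Δ.2.2.2 i < 0 ∧ t = γ * (-w.s i / Δ.2.2.2 i)} ∪
    {t | ∃ i, Δ.2.2.1 i < 0 ∧ t = γ * (-w.z i / Δ.2.2.1 i)}

lemma finite_stepCandidates : (stepCandidates w Δ γ).Finite := by
  refine ((Set.finite_singleton _).union ?_).union ?_
  · refine (Set.finite_range fun i ↦ γ * (-w.s i / Δ.2.2.2 i)).subset ?_
    rintro t ⟨i, -, rfl⟩
    exact ⟨i, rfl⟩
  · refine (Set.finite_range fun i ↦ γ * (-w.z i / Δ.2.2.1 i)).subset ?_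
    rintro t ⟨i, -, rfl⟩
    exact ⟨i, rfl⟩

lemma stepSize_mem : stepSize w Δ γ ∈ stepCandidates w Δ γ :=
  Set.Nonempty.csInf_mem ⟨1, Or.inl (Or.inl rfl)⟩ (finite_stepCandidates w Δ γ)

lemma stepSize_le {t : ℝ} (ht : t ∈ stepCandidates w Δ γ) : stepSize w Δ γ ≤ t :=
  csInf_le (finite_stepCandidates w Δ γ).bddBelow ht

lemma stepSize_le_one : stepSize w Δ γ ≤ 1 :=
  stepSize_le w Δ γ (by simp [stepCandidates])

lemma lt_stepSize {a : ℝ} (h1 : a < 1)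
    (hs : ∀ i, Δ.2.2.2 i < 0 → a < γ * (-w.s i / Δ.2.2.2 i))
    (hz : ∀ i, Δ.2.2.1 i < 0 → a < γ * (-w.z i / Δ.2.2.1 i)) : a < stepSize w Δ γ := by
  rcases stepSize_mem w Δ γ with (h | ⟨i, hi, h⟩) | ⟨i, hi, h⟩
  · rwa [h]
  · rw [h]; exact hs i hi
  · rw [h]; exact hz i hi

lemma le_stepSize {a : ℝ} (h1 : a ≤ 1)
    (hs : ∀ i, Δ.2.2.2 i < 0 → a ≤ γ * (-w.s i / Δ.2.2.2 i))
    (hz : ∀ i, Δ.2.2.1 i < 0 → a ≤ γ * (-w.z i / Δ.2.2.1 i)) : a ≤ stepSize w Δ γ := by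
  rcases stepSize_mem w Δ γ with (h | ⟨i, hi, h⟩) | ⟨i, hi, h⟩
  · rwa [h]
  · rw [h]; exact hs i hi
  · rw [h]; exact hz i hi

/-- For `d < 0` the new value is at least `(1 - γ) a`. Since `γ = 1` can put iterates on the
boundary, `a = 0` is allowed; `had` then says that the direction points inward. -/
lemma fraction_to_boundary {a d α γ : ℝ} (ha : 0 ≤ a) (had : d ≤ 0 → 0 < a) (hα : 0 < α)
    (hγ : γ ≤ 1) (h : d < 0 → α ≤ γ * (-a / d)) :
    0 ≤ a + α * d ∧ (γ < 1 → 0 < a + α * d) := by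
  rcases lt_trichotomy d 0 with hd | rfl | hd
  · have h1 : α * d ≥ -γ * a := by
      have := mul_le_mul_of_nonpos_right (h hd) hd.le
      have h2 : γ * (-a / d) * d = -γ * a := by field_simp [hd.ne]
      linarith
    have := had hd.le
    constructor
    · nlinarith
    · intro; nlinarith
  · have := had le_rfl
    simp [this, this.le]
  · have : 0 < α * d := by positivity
    exact ⟨by linarith, fun _ ↦ by linarith⟩

lemma fraction_lower_bound {a d γ b : ℝ} (hγ : 0 ≤ γ) (hb : 0 ≤ b)
    (hd : d < 0) (h : -(1 + b) * a ≤ d) : γ / (1 + b) ≤ γ * (-a / d) := by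
  rw [div_eq_mul_inv]
  gcongr
  rw [neg_div, ← div_neg, le_div_iff₀ (by linarith), inv_mul_le_iff₀ (by positivity)]
  linarith

/-- Consequences of the linearized complementarity equation `z Δs + s Δz = -z s + μ`. -/
lemma complementarity_pair {s z ds dz μ κ ρ : ℝ} (hμ : 0 < μ) (hκ : 0 < κ) (hs : 0 ≤ s)
    (hz : κ ≤ z) (hdz : |dz| ≤ κ * ρ) (h : z * ds + s * dz = -(z * s) + μ) :
    (ds ≤ 0 → 0 < s) ∧ (dz ≤ 0 → 0 < z) ∧ -(1 + ρ) * s ≤ ds ∧ -(1 + ρ) * z ≤ dz := by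
  have hz0 : 0 < z := hκ.trans_le hz
  have hρ : 0 ≤ ρ := nonneg_of_mul_nonneg_right ((abs_nonneg _).trans hdz) hκ
  have hdz' := abs_le.1 hdz
  refine ⟨fun hd ↦ ?_, fun _ ↦ hz0, ?_, ?_⟩
  -- At `s = 0` the equation reads `z ds = μ > 0`, so the direction points into the interior.
  · by_contra hs0
    have : s = 0 := le_antisymm (not_lt.1 hs0) hs
    subst this
    nlinarith
  -- Solving for the other component, `z ds ≥ -z s - s dz`, and `dz` is at most `κ ρ ≤ z ρ`.
  · have h1 : z * ds ≥ z * (-(1 + ρ) * s) := by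
      have : s * dz ≤ s * (κ * ρ) := mul_le_mul_of_nonneg_left hdz'.2 hs
      have : s * (κ * ρ) ≤ s * (z * ρ) := by gcongr
      nlinarith
    exact le_of_mul_le_mul_left h1 hz0
  · have : κ * ρ ≤ z * ρ := by gcongr
    nlinarith

/-- The step size when every complementarity pair has a component bounded away from zero. -/
lemma stepSize_spec {μ κ ρ : ℝ} (hμ : 0 < μ) (hκ : 0 < κ) (hρ : 0 ≤ ρ) (hγ : 0 < γ) (hγ1 : γ ≤ 1)
    (hz : ∀ i, 0 ≤ w.z i) (hs : ∀ i, 0 ≤ w.s i) (hpair : ∀ i, κ ≤ w.z i ∨ κ ≤ w.s i)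
    (hdz : ∀ i, |Δ.2.2.1 i| ≤ κ * ρ) (hds : ∀ i, |Δ.2.2.2 i| ≤ κ * ρ)
    (heq : ∀ i, w.z i * Δ.2.2.2 i + w.s i * Δ.2.2.1 i = -(w.z i * w.s i) + μ) :
    (0 < stepSize w Δ γ ∧ stepSize w Δ γ ≤ 1 ∧
    (∀ i, 0 ≤ w.z i + stepSize w Δ γ * Δ.2.2.1 i ∧ 0 ≤ w.s i + stepSize w Δ γ * Δ.2.2.2 i) ∧
    (γ < 1 → ∀ i,
      0 < w.z i + stepSize w Δ γ * Δ.2.2.1 i ∧ 0 < w.s i + stepSize w Δ γ * Δ.2.2.2 i)) ∧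
    1 - stepSize w Δ γ ≤ 1 - γ + ρ := by
  have key : ∀ i, (Δ.2.2.2 i ≤ 0 → 0 < w.s i) ∧ (Δ.2.2.1 i ≤ 0 → 0 < w.z i) ∧
      -(1 + ρ) * w.s i ≤ Δ.2.2.2 i ∧ -(1 + ρ) * w.z i ≤ Δ.2.2.1 i := by
    intro i
    rcases hpair i with h | h
    · exact complementarity_pair hμ hκ (hs i) h (hdz i) (heq i)
    -- The equation is symmetric, so `z` and `s` exchange roles when `s` is the large component.
    · obtain ⟨h1, h2, h3, h4⟩ := complementarity_pair hμ hκ (hz i) h (hds i)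
        (by linarith [heq i] : w.s i * Δ.2.2.1 i + w.z i * Δ.2.2.2 i = -(w.s i * w.z i) + μ)
      exact ⟨h2, h1, h4, h3⟩
  have hpos : 0 < stepSize w Δ γ := by
    refine lt_stepSize w Δ γ one_pos (fun i hi ↦ ?_) (fun i hi ↦ ?_)
    · have := (key i).1 hi.le
      exact mul_pos hγ (div_pos_of_neg_of_neg (by linarith) hi)
    · have := (key i).2.1 hi.le
      exact mul_pos hγ (div_pos_of_neg_of_neg (by linarith) hi)
  have hlow : γ / (1 + ρ) ≤ stepSize w Δ γ := by
    refine le_stepSize w Δ γ ?_ (fun i hi ↦ fraction_lower_bound hγ.le hρ hi (key i).2.2.1)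
      (fun i hi ↦ fraction_lower_bound hγ.le hρ hi (key i).2.2.2)
    rw [div_le_one (by positivity)]
    linarith
  have hzs : ∀ i, _ ∧ _ := fun i ↦ ⟨fraction_to_boundary (hz i) (key i).2.1 hpos hγ1
    (fun hi ↦ stepSize_le w Δ γ (Or.inr ⟨i, hi, rfl⟩)), fraction_to_boundary (hs i) (key i).1 hpos hγ1
    (fun hi ↦ stepSize_le w Δ γ (Or.inl (Or.inr ⟨i, hi, rfl⟩)))⟩
  refine ⟨⟨hpos, stepSize_le_one w Δ γ, fun i ↦ ⟨(hzs i).1.1, (hzs i).2.1⟩,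
    fun h i ↦ ⟨(hzs i).1.2 h, (hzs i).2.2 h⟩⟩, ?_⟩
  -- `(γ - ρ)(1 + ρ) = γ - (1 - γ) ρ - ρ²`, which is at most `γ` because `γ ≤ 1`.
  have : γ - ρ ≤ γ / (1 + ρ) := by
    rw [le_div_iff₀ (by positivity)]
    nlinarith
  linarith

end StepSize

/-! ### Local bounds for the Christoffel symbols. -/

section Christoffel

variable {E : Type*} [NormedAddCommGroup E] [NormedSpace ℝ E] [FiniteDimensional ℝ E]
  {M : Type*} [MetricSpace M] [ChartedSpace E M] [IsManifold 𝓘(ℝ, E) ∞ M]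
  [RiemannianBundle (fun x : M ↦ TangentSpace 𝓘(ℝ, E) x)]
  [IsContMDiffRiemannianBundle 𝓘(ℝ, E) ∞ E (fun x : M ↦ TangentSpace 𝓘(ℝ, E) x)]

/-- For fixed `v` the expression is bilinear in the coordinates of `ξ` and `η`, so finitely many
bounds on basis vectors suffice, and these hold on a common neighbourhood. -/
lemma eventually_christoffel_bound (p : M) (v : E) :
    ∃ C > 0, ∀ᶠ x in 𝓝 p, ∀ ξ η : TangentSpace 𝓘(ℝ, E) x,
      |inner ℝ η (leviCivita E M (chartField p v) x ξ)| ≤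
        C * ‖chartCoord p x ξ‖ * ‖chartCoord p x η‖ := by
  let b := Module.finBasis ℝ E
  obtain ⟨C, hC, hb⟩ := b.exists_bilinear_bound
  choose K hK hKx using fun i j ↦ eventually_abs_inner_leviCivita_le (M := M) p (b i) v (b j)
  have hS : 0 ≤ ∑ i, ∑ j, K i j :=
    Finset.sum_nonneg fun i _ ↦ Finset.sum_nonneg fun j _ ↦ (hK i j).le
  refine ⟨C * (∑ i, ∑ j, K i j + 1), by positivity, ?_⟩
  filter_upwards [eventually_all.2 fun i ↦ eventually_all.2 fun j ↦ hKx i j,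
    eventually_mem_source (mem_extChartAt_source (I := 𝓘(ℝ, E)) p)] with x hx hxs ξ η
  let T : E →ₗ[ℝ] E →ₗ[ℝ] ℝ := LinearMap.mk₂ ℝ
    (fun u w ↦ inner ℝ (leviCivita E M (chartField p v) x (chartField p u x)) (chartField p w x))
    (fun _ _ _ ↦ by rw [chartField_add, map_add, inner_add_left])
    (fun _ _ _ ↦ by rw [chartField_smul, map_smul, real_inner_smul_left, smul_eq_mul])
    (fun _ _ _ ↦ by rw [chartField_add, inner_add_right])
    (fun _ _ _ ↦ by rw [chartField_smul, real_inner_smul_right, smul_eq_mul])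
  have hT := hb T (∑ i, ∑ j, K i j + 1) (by positivity)
    (fun i j ↦ (hx i j).trans ?_) (chartCoord p x ξ) (chartCoord p x η)
  · simpa only [T, LinearMap.mk₂_apply, chartField_chartCoord hxs, real_inner_comm] using hT
  · have h1 : K i j ≤ ∑ j, K i j :=
      Finset.single_le_sum (f := fun j ↦ K i j) (fun j _ ↦ (hK i j).le) (Finset.mem_univ j)
    have h2 : ∑ j, K i j ≤ ∑ i, ∑ j, K i j :=
      Finset.single_le_sum (f := fun i ↦ ∑ j, K i j)
        (fun i _ ↦ Finset.sum_nonneg fun j _ ↦ (hK i j).le) (Finset.mem_univ i)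
    linarith

end Christoffel

/-! ### The KKT field and its derivatives in coordinates. -/

section KKTChart

/-- The space of coordinates `(u, y, z, s)` of points and tangent vectors of `N`. -/
abbrev ChartSpace (E : Type*) (l m : ℕ) : Type _ :=
  E × EuclideanSpace ℝ (Fin l) × EuclideanSpace ℝ (Fin m) × EuclideanSpace ℝ (Fin m)

/-- The space in which the KKT field takes its values, in coordinates. -/
abbrev ChartDual (E : Type*) [NormedAddCommGroup E] [NormedSpace ℝ E] (l m : ℕ) : Type _ :=
  (E →L[ℝ] ℝ) × EuclideanSpace ℝ (Fin l) × EuclideanSpace ℝ (Fin m) × EuclideanSpace ℝ (Fin m)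

variable {E : Type*} [NormedAddCommGroup E] [NormedSpace ℝ E] [FiniteDimensional ℝ E]
  {M : Type*} [MetricSpace M] [ChartedSpace E M] [IsManifold 𝓘(ℝ, E) ∞ M]
  {l m : ℕ}

variable (E) in
/-- The coordinates of a point of `N` in the chart around `p`. -/
def PDPoint.chart (p : M) (w : PDPoint M l m) : ChartSpace E l m :=
  (extChartAt 𝓘(ℝ, E) p w.x, w.y, w.z, w.s)

/-- The coordinates of a tangent vector of `N` in the chart around `p`. -/
def tangentChart (p : M) (w : PDPoint M l m) : PDTangent E w →ₗ[ℝ] ChartSpace E l m :=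
  (chartCoord (E := E) p w.x).toLinearMap.prodMap LinearMap.id

lemma tangentChart_apply (p : M) (w : PDPoint M l m) (Δ : PDTangent E w) :
    tangentChart p w Δ = (chartCoord p w.x Δ.1, Δ.2) := rfl

variable [RiemannianBundle (fun x : M ↦ TangentSpace 𝓘(ℝ, E) x)]
  [IsContMDiffRiemannianBundle 𝓘(ℝ, E) ∞ E (fun x : M ↦ TangentSpace 𝓘(ℝ, E) x)]

/-- The covector, in coordinates, which is dual to a tangent vector. -/
def chartFlat (p x : M) : TangentSpace 𝓘(ℝ, E) x →ₗ[ℝ] (E →L[ℝ] ℝ) where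
  toFun ξ := LinearMap.toContinuousLinearMap
    { toFun := fun v ↦ inner ℝ ξ (chartField p v x)
      map_add' := fun _ _ ↦ by rw [chartField_add, inner_add_right]
      map_smul' := fun _ _ ↦ by rw [chartField_smul, real_inner_smul_right]; rfl }
  map_add' ξ η := by ext v; exact inner_add_left ξ η (chartField p v x)
  map_smul' c ξ := by ext v; exact real_inner_smul_left ξ (chartField p v x) c

lemma chartFlat_apply (p x : M) (ξ : TangentSpace 𝓘(ℝ, E) x) (v : E) :
    chartFlat p x ξ v = inner ℝ ξ (chartField p v x) := rfl

lemma chartFlat_injective {p x : M} (hx : x ∈ (extChartAt 𝓘(ℝ, E) p).source) :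
    Function.Injective (chartFlat (E := E) p x) := by
  rw [injective_iff_map_eq_zero]
  intro ξ hξ
  have h := chartFlat_apply p x ξ (chartCoord p x ξ)
  rw [hξ, chartField_chartCoord hx] at h
  exact inner_self_eq_zero.1 h.symm

/-- Pairing of tangent vectors of `N` with the coordinate fields of the chart around `p`. -/
def tangentFlat (p : M) (w : PDPoint M l m) : PDTangent E w →ₗ[ℝ] ChartDual E l m :=
  (chartFlat p w.x).prodMap LinearMap.id

lemma tangentFlat_apply (p : M) (w : PDPoint M l m) (Δ : PDTangent E w) :
    tangentFlat p w Δ = (chartFlat p w.x Δ.1, Δ.2) := rfl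

lemma tangentFlat_injective {p : M} {w : PDPoint M l m}
    (hx : w.x ∈ (extChartAt 𝓘(ℝ, E) p).source) :
    Function.Injective (tangentFlat (E := E) p w) :=
  (chartFlat_injective hx).prodMap Function.injective_id

variable (X : Type*) [NormedAddCommGroup X] [NormedSpace ℝ X] (l m) in
/-- The coordinate `(u, y, z, s) ↦ y_i`. -/
def projY (i : Fin l) : X × EuclideanSpace ℝ (Fin l) × EuclideanSpace ℝ (Fin m) ×
    EuclideanSpace ℝ (Fin m) →L[ℝ] ℝ :=
  EuclideanSpace.proj i ∘L ContinuousLinearMap.fst ℝ _ _ ∘L ContinuousLinearMap.snd ℝ _ _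

variable (X : Type*) [NormedAddCommGroup X] [NormedSpace ℝ X] (l m) in
/-- The coordinate `(u, y, z, s) ↦ z_i`. -/
def projZ (i : Fin m) : X × EuclideanSpace ℝ (Fin l) × EuclideanSpace ℝ (Fin m) ×
    EuclideanSpace ℝ (Fin m) →L[ℝ] ℝ :=
  EuclideanSpace.proj i ∘L ContinuousLinearMap.fst ℝ _ _ ∘L ContinuousLinearMap.snd ℝ _ _ ∘L
    ContinuousLinearMap.snd ℝ _ _

variable (X : Type*) [NormedAddCommGroup X] [NormedSpace ℝ X] (l m) in
/-- The coordinate `(u, y, z, s) ↦ s_i`. -/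
def projS (i : Fin m) : X × EuclideanSpace ℝ (Fin l) × EuclideanSpace ℝ (Fin m) ×
    EuclideanSpace ℝ (Fin m) →L[ℝ] ℝ :=
  EuclideanSpace.proj i ∘L ContinuousLinearMap.snd ℝ _ _ ∘L ContinuousLinearMap.snd ℝ _ _ ∘L
    ContinuousLinearMap.snd ℝ _ _

/-- Allows the derivative of a product-valued map to be computed one component at a time. -/
lemma apply_fderiv_eq {V W K : Type*} [NormedAddCommGroup V] [NormedSpace ℝ V]
    [NormedAddCommGroup W] [NormedSpace ℝ W] [NormedAddCommGroup K] [NormedSpace ℝ K] (L : W →L[ℝ] K)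
    {G : V → W} {q : V} (hG : DifferentiableAt ℝ G q) {D : V →L[ℝ] K}
    (h : HasFDerivAt (fun q ↦ L (G q)) D q) (δ : V) : L (fderiv ℝ G q δ) = D δ :=
  congr($((L.hasFDerivAt.comp q hG.hasFDerivAt).unique h) δ)

namespace RCOP

variable (P : RCOP E M l m) (p : M)

lemma smooth_lagrangian (y : EuclideanSpace ℝ (Fin l)) (z : EuclideanSpace ℝ (Fin m)) :
    ContMDiff 𝓘(ℝ, E) 𝓘(ℝ, ℝ) ∞ (P.lagrangian y z) := by
  unfold lagrangian
  refine (P.smooth_f.add ?_).add ?_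
  · exact contMDiff_finsetSum fun i _ ↦ contMDiff_const.mul (P.smooth_h i)
  · exact contMDiff_finsetSum fun i _ ↦ contMDiff_const.mul (P.smooth_g i)

/-- The expression of a function on `M` in the chart around `p`. -/
def inChart (p : M) (φ : M → ℝ) : E → ℝ := φ ∘ (extChartAt 𝓘(ℝ, E) p).symm

variable {p} in
lemma contDiffAt_inChart {φ : M → ℝ} (hφ : ContMDiff 𝓘(ℝ, E) 𝓘(ℝ, ℝ) ∞ φ) {u : E}
    (hu : u ∈ (extChartAt 𝓘(ℝ, E) p).target) : ContDiffAt ℝ ∞ (inChart p φ) u := by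
  have h := contDiffAt_comp_extChartAt_symm le_rfl ((extChartAt 𝓘(ℝ, E) p).map_target hu) (hφ _)
  rwa [(extChartAt 𝓘(ℝ, E) p).right_inv hu] at h

/-- The expression of the KKT vector field in the chart around `p`. -/
def kktChart (q : ChartSpace E l m) : ChartDual E l m :=
  (fderiv ℝ (inChart p P.f) q.1 + ∑ i, q.2.1 i • fderiv ℝ (inChart p (P.h i)) q.1
      + ∑ i, q.2.2.1 i • fderiv ℝ (inChart p (P.g i)) q.1,
    WithLp.toLp 2 fun i ↦ inChart p (P.h i) q.1,
    WithLp.toLp 2 fun i ↦ inChart p (P.g i) q.1 + q.2.2.2 i,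
    WithLp.toLp 2 fun i ↦ q.2.2.1 i * q.2.2.2 i)

variable {p} in
lemma fderiv_inChart_lagrangian {u : E} (hu : u ∈ (extChartAt 𝓘(ℝ, E) p).target)
    (y : EuclideanSpace ℝ (Fin l)) (z : EuclideanSpace ℝ (Fin m)) :
    fderiv ℝ (inChart p (P.lagrangian y z)) u =
      fderiv ℝ (inChart p P.f) u + ∑ i, y i • fderiv ℝ (inChart p (P.h i)) u
      + ∑ i, z i • fderiv ℝ (inChart p (P.g i)) u := by
  have hd : ∀ {φ : M → ℝ}, ContMDiff 𝓘(ℝ, E) 𝓘(ℝ, ℝ) ∞ φ →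
      HasFDerivAt (inChart p φ) (fderiv ℝ (inChart (E := E) p φ) u) u := fun hφ ↦
    ((contDiffAt_inChart hφ hu).differentiableAt (by simp)).hasFDerivAt
  exact (((hd P.smooth_f).add (HasFDerivAt.fun_sum fun i _ ↦ (hd (P.smooth_h i)).const_mul (y i))).add
    (HasFDerivAt.fun_sum fun i _ ↦ (hd (P.smooth_g i)).const_mul (z i))).fderiv

variable {p} in
-- Lowering the index replaces the gradient by the differential, so the metric disappears from the
-- coordinate expression.
lemma tangentFlat_kktField {w : PDPoint M l m} (hx : w.x ∈ (extChartAt 𝓘(ℝ, E) p).source) :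
    tangentFlat p w (P.kktField w) = P.kktChart p (w.chart E p) := by
  refine Prod.ext ?_ ?_
  · have h := P.fderiv_inChart_lagrangian ((extChartAt 𝓘(ℝ, E) p).map_source hx) w.y w.z
    refine Eq.trans ?_ h
    ext v
    exact inner_grad_chartField (P.smooth_lagrangian w.y w.z) hx v
  · simp only [tangentFlat_apply, kktField, kktChart, PDPoint.chart, inChart, Function.comp_apply,
      (extChartAt 𝓘(ℝ, E) p).left_inv hx]

variable {p} in
lemma contDiffAt_kktChart {q : ChartSpace E l m} (hq : q.1 ∈ (extChartAt 𝓘(ℝ, E) p).target) :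
    ContDiffAt ℝ 2 (P.kktChart p) q := by
  have hφ : ∀ {φ : M → ℝ}, ContMDiff 𝓘(ℝ, E) 𝓘(ℝ, ℝ) ∞ φ →
      ContDiffAt ℝ 2 (fun q : ChartSpace E l m ↦ inChart (E := E) p φ q.1) q := fun hφ ↦
    ((contDiffAt_inChart hφ hq).of_le ENat.LEInfty.out).comp q contDiffAt_fst
  have hd : ∀ {φ : M → ℝ}, ContMDiff 𝓘(ℝ, E) 𝓘(ℝ, ℝ) ∞ φ →
      ContDiffAt ℝ 2 (fun q : ChartSpace E l m ↦ fderiv ℝ (inChart (E := E) p φ) q.1) q := fun hφ ↦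
    ((contDiffAt_inChart hφ hq).fderiv_right (m := 2) (by norm_cast)).comp q contDiffAt_fst
  refine ContDiffAt.prodMk (((hd P.smooth_f).add ?_).add ?_)
    (ContDiffAt.prodMk ?_ (ContDiffAt.prodMk ?_ ?_))
  · refine ContDiffAt.sum fun i _ ↦ ContDiffAt.fun_smul ?_ (hd (P.smooth_h i))
    fun_prop
  · refine ContDiffAt.sum fun i _ ↦ ContDiffAt.fun_smul ?_ (hd (P.smooth_g i))
    fun_prop
  · exact contDiffAt_euclidean.2 fun i ↦ hφ (P.smooth_h i)
  · exact contDiffAt_euclidean.2 fun i ↦ (hφ (P.smooth_g i)).add (by fun_prop)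
  · exact contDiffAt_euclidean.2 fun i ↦ ContDiffAt.mul (by fun_prop) (by fun_prop)

variable {p} in
lemma fderiv_kktChart {q : ChartSpace E l m} (hq : q.1 ∈ (extChartAt 𝓘(ℝ, E) p).target)
    (δ : ChartSpace E l m) :
    fderiv ℝ (P.kktChart p) q δ =
      (fderiv ℝ (fderiv ℝ (inChart p (P.lagrangian q.2.1 q.2.2.1))) q.1 δ.1
        + ∑ i, δ.2.1 i • fderiv ℝ (inChart p (P.h i)) q.1
        + ∑ i, δ.2.2.1 i • fderiv ℝ (inChart p (P.g i)) q.1,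
      WithLp.toLp 2 fun i ↦ fderiv ℝ (inChart p (P.h i)) q.1 δ.1,
      WithLp.toLp 2 fun i ↦ fderiv ℝ (inChart p (P.g i)) q.1 δ.1 + δ.2.2.2 i,
      WithLp.toLp 2 fun i ↦ q.2.2.1 i * δ.2.2.2 i + q.2.2.2 i * δ.2.2.1 i) := by
  have hφ : ∀ {φ : M → ℝ}, ContMDiff 𝓘(ℝ, E) 𝓘(ℝ, ℝ) ∞ φ →
      HasFDerivAt (inChart (E := E) p φ) (fderiv ℝ (inChart (E := E) p φ) q.1) q.1 := fun hφ ↦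
    ((contDiffAt_inChart hφ hq).differentiableAt (by simp)).hasFDerivAt
  have hd : ∀ {φ : M → ℝ}, ContMDiff 𝓘(ℝ, E) 𝓘(ℝ, ℝ) ∞ φ →
      HasFDerivAt (fderiv ℝ (inChart (E := E) p φ)) (fderiv ℝ (fderiv ℝ (inChart (E := E) p φ)) q.1) q.1 :=
    fun hφ ↦ (((contDiffAt_inChart hφ hq).fderiv_right (m := 1) (by norm_cast)).differentiableAt
      (by simp)).hasFDerivAt
  -- The multipliers are frozen at those of `q`; their own variation produces the remaining two sums
  -- of the first component.
  have hL : fderiv ℝ (fderiv ℝ (inChart p (P.lagrangian q.2.1 q.2.2.1))) q.1 =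
      fderiv ℝ (fderiv ℝ (inChart p P.f)) q.1
      + ∑ i, q.2.1 i • fderiv ℝ (fderiv ℝ (inChart p (P.h i))) q.1
      + ∑ i, q.2.2.1 i • fderiv ℝ (fderiv ℝ (inChart p (P.g i))) q.1 := by
    refine HasFDerivAt.fderiv (HasFDerivAt.congr_of_eventuallyEq
      (((hd P.smooth_f).add (HasFDerivAt.fun_sum fun i _ ↦ (hd (P.smooth_h i)).const_smul (q.2.1 i))).add
      (HasFDerivAt.fun_sum fun i _ ↦ (hd (P.smooth_g i)).const_smul (q.2.2.1 i))) ?_)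
    filter_upwards [(isOpen_extChartAt_target p).mem_nhds hq] with u hu
    exact P.fderiv_inChart_lagrangian hu q.2.1 q.2.2.1
  have hfst : HasFDerivAt (fun q : ChartSpace E l m ↦ q.1) (ContinuousLinearMap.fst ℝ E _) q :=
    hasFDerivAt_fst
  have hy : ∀ i, HasFDerivAt (fun q : ChartSpace E l m ↦ q.2.1 i) (projY l m E i) q := fun i ↦
    (projY l m E i).hasFDerivAt
  have hz : ∀ i, HasFDerivAt (fun q : ChartSpace E l m ↦ q.2.2.1 i) (projZ l m E i) q := fun i ↦
    (projZ l m E i).hasFDerivAt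
  have hs : ∀ i, HasFDerivAt (fun q : ChartSpace E l m ↦ q.2.2.2 i) (projS l m E i) q := fun i ↦
    (projS l m E i).hasFDerivAt
  have hD := (P.contDiffAt_kktChart hq).differentiableAt (by simp)
  have h1 : HasFDerivAt (fun q ↦ (P.kktChart p q).1) _ q :=
    (((hd P.smooth_f).comp q hfst).add
      (HasFDerivAt.fun_sum fun i _ ↦ (hy i).smul ((hd (P.smooth_h i)).comp q hfst))).add
      (HasFDerivAt.fun_sum fun i _ ↦ (hz i).smul ((hd (P.smooth_g i)).comp q hfst))
  have h2 : ∀ i, HasFDerivAt (fun q ↦ (P.kktChart p q).2.1 i) _ q := fun i ↦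
    (hφ (P.smooth_h i)).comp q hfst
  have h3 : ∀ i, HasFDerivAt (fun q ↦ (P.kktChart p q).2.2.1 i) _ q := fun i ↦
    ((hφ (P.smooth_g i)).comp q hfst).add (hs i)
  have h4 : ∀ i, HasFDerivAt (fun q ↦ (P.kktChart p q).2.2.2 i) _ q := fun i ↦
    (hz i).mul (hs i)
  refine Prod.ext ?_ (Prod.ext ?_ (Prod.ext ?_ ?_))
  · refine (apply_fderiv_eq (ContinuousLinearMap.fst ℝ (E →L[ℝ] ℝ) _) hD h1 δ).trans ?_
    rw [hL]
    simp [Finset.sum_add_distrib, sum_apply, projY, projZ]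
    abel
  · ext i
    exact apply_fderiv_eq (projY l m (E →L[ℝ] ℝ) i) hD (h2 i) δ
  · ext i
    exact apply_fderiv_eq (projZ l m (E →L[ℝ] ℝ) i) hD (h3 i) δ
  · ext i
    exact apply_fderiv_eq (projS l m (E →L[ℝ] ℝ) i) hD (h4 i) δ

variable {p} in
/-- The derivative of the KKT field in coordinates differs from its covariant derivative by a term
which involves the Christoffel symbols. -/
lemma fderiv_kktChart_sub {w : PDPoint M l m} (hx : w.x ∈ (extChartAt 𝓘(ℝ, E) p).source)
    (Δ : PDTangent E w) :
    (fderiv ℝ (P.kktChart p) (w.chart E p) (tangentChart p w Δ) -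
      tangentFlat p w (P.covDerivKKT w Δ)).2 = 0 ∧
    ∀ v, (fderiv ℝ (P.kktChart p) (w.chart E p) (tangentChart p w Δ) -
      tangentFlat p w (P.covDerivKKT w Δ)).1 v =
        inner ℝ (P.gradL w) (leviCivita E M (chartField p v) w.x Δ.1) := by
  have hu := (extChartAt 𝓘(ℝ, E) p).map_source hx
  have hgrad : ∀ {φ : M → ℝ}, ContMDiff 𝓘(ℝ, E) 𝓘(ℝ, ℝ) ∞ φ →
      fderiv ℝ (inChart p φ) (extChartAt 𝓘(ℝ, E) p w.x) (chartCoord p w.x Δ.1) =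
      inner ℝ (grad φ w.x) Δ.1 := fun hφ ↦ by
    have := inner_grad_chartField hφ hx (chartCoord p w.x Δ.1)
    rw [chartField_chartCoord hx] at this
    exact this.symm
  rw [P.fderiv_kktChart (q := w.chart E p) hu]
  constructor
  · rw [Prod.snd_sub, sub_eq_zero]
    refine Prod.ext ?_ (Prod.ext ?_ ?_)
    · ext i; exact hgrad (P.smooth_h i)
    · ext i; exact congr($(hgrad (P.smooth_g i)) + Δ.2.2.2 i)
    · rfl
  · intro v
    -- Only the Hessian term feels the connection; the constraint gradients contribute equally to
    -- both derivatives and cancel.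
    have h1 := inner_hess_chartField (P.smooth_lagrangian w.y w.z) hx Δ.1 v
    have h2 : chartFlat p w.x (P.covDerivKKT w Δ).1 v = inner ℝ (P.hessL w Δ.1) (chartField p v w.x)
        + ∑ i, Δ.2.1 i * fderiv ℝ (inChart p (P.h i)) (extChartAt 𝓘(ℝ, E) p w.x) v
        + ∑ i, Δ.2.2.1 i * fderiv ℝ (inChart p (P.g i)) (extChartAt 𝓘(ℝ, E) p w.x) v := by
      rw [chartFlat_apply]
      simp only [covDerivKKT, LinearMap.coe_mk, AddHom.coe_mk, inner_add_left, sum_inner,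
        real_inner_smul_left]
      congr! with i _ i _
      · exact inner_grad_chartField (P.smooth_h i) hx v
      · exact inner_grad_chartField (P.smooth_g i) hx v
    rw [Prod.fst_sub, sub_apply, tangentFlat_apply, h2, hessL, h1]
    simp only [add_apply, sum_apply, smul_apply, smul_eq_mul, gradL, inChart, PDPoint.chart, tangentChart_apply]
    ring

/-- Nonsingularity of the covariant derivative of the KKT field at a solution. -/
lemma StandardAssumptions.injective_covDerivKKT {P : RCOP E M l m} {w : PDPoint M l m}
    (h : P.StandardAssumptions w) : Function.Injective (P.covDerivKKT w) := by
  rw [injective_iff_map_eq_zero]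
  rintro ⟨ξ, a, b, c⟩ hΔ
  have e1 : P.hessL w ξ + ∑ i, a i • grad (P.h i) w.x + ∑ i, b i • grad (P.g i) w.x = 0 :=
    congr(($hΔ).1)
  have e2 : ∀ i, inner ℝ (grad (P.h i) w.x) ξ = 0 := fun i ↦ congr(($hΔ).2.1 i)
  have e3 : ∀ i, inner ℝ (grad (P.g i) w.x) ξ + c i = 0 := fun i ↦ congr(($hΔ).2.2.1 i)
  have e4 : ∀ i, w.z i * c i + w.s i * b i = 0 := fun i ↦ congr(($hΔ).2.2.2 i)
  -- For an active constraint the slack is zero and the multiplier is positive; for an inactive one,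
  -- below, the reverse holds and `b i` vanishes.
  have hact : ∀ i, P.g i w.x = 0 → c i = 0 := by
    intro i hi
    have h1 := e4 i
    rw [h.slack i, hi, neg_zero, zero_mul, add_zero] at h1
    exact (mul_eq_zero.1 h1).resolve_left (h.strict_complementarity i hi).ne'
  have hact' : ∀ i, P.g i w.x = 0 → inner ℝ (grad (P.g i) w.x) ξ = 0 := by
    intro i hi
    have h1 := e3 i
    rwa [hact i hi, add_zero] at h1
  have hinact : ∀ i, P.g i w.x ≠ 0 → b i = 0 := by
    intro i hi
    have h1 := e4 i
    rw [(mul_eq_zero.1 (h.complementarity i)).resolve_right hi, zero_mul, zero_add, h.slack i] at h1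
    exact (mul_eq_zero.1 h1).resolve_left (neg_ne_zero.2 hi)
  have hξ : ξ = 0 := by
    by_contra hne
    have hpos := h.second_order ξ hne (fun i ↦ by rw [real_inner_comm]; exact e2 i)
      (fun i hi ↦ by rw [real_inner_comm]; exact hact' i hi)
    -- `ξ` is orthogonal to all active gradients and inactive multipliers are zero, so pairing with
    -- `ξ` leaves `⟨Hess L ξ, ξ⟩ = 0`, against the second-order condition.
    have h1 := congrArg (fun η ↦ inner ℝ η ξ) e1
    simp only [inner_add_left, sum_inner, real_inner_smul_left, inner_zero_left, e2, mul_zero,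
      Finset.sum_const_zero, add_zero] at h1
    have h2 : ∑ i, b i * inner ℝ (grad (P.g i) w.x) ξ = 0 := by
      refine Finset.sum_eq_zero fun i _ ↦ ?_
      by_cases hi : P.g i w.x = 0
      · rw [hact' i hi, mul_zero]
      · rw [hinact i hi, zero_mul]
    linarith
  subst hξ
  rw [map_zero, zero_add] at e1
  -- With `ξ = 0`, a vanishing combination of equality and active gradients remains, to which linear
  -- independence applies.
  have h5 : ∑ i, b i • grad (E := E) (P.g i) w.x =
      ∑ i : {i : Fin m // P.g i w.x = 0}, b i • grad (E := E) (P.g i) w.x := by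
    classical
    rw [← Finset.sum_subtype (Finset.univ.filter fun i ↦ P.g i w.x = 0) (by simp)
      (fun i ↦ b i • grad (E := E) (P.g i) w.x), Finset.sum_filter_of_ne]
    intro i _ hi
    by_contra hne
    exact hi (by rw [hinact i hne, zero_smul])
  rw [h5] at e1
  have h6 := Fintype.linearIndependent_iff.1 h.licq (Sum.elim (fun i ↦ a i) (fun i ↦ b i)) (by
    rw [Fintype.sum_sum_type]
    exact e1)
  have ha : a = 0 := by ext i; exact h6 (Sum.inl i)
  have hb : b = 0 := by
    ext i
    by_cases hi : P.g i w.x = 0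
    · exact h6 (Sum.inr ⟨i, hi⟩)
    · exact hinact i hi
  have hc : c = 0 := by
    ext i
    have := e3 i
    simpa using this
  rw [ha, hb, hc]
  rfl

end RCOP

end KKTChart

/-! ### Newton estimates near the solution. -/

section LocalModel

variable {E : Type*} [NormedAddCommGroup E] [NormedSpace ℝ E] [FiniteDimensional ℝ E]
  {M : Type*} [MetricSpace M] [ChartedSpace E M] [IsManifold 𝓘(ℝ, E) ∞ M]
  {l m : ℕ}

variable (E) in
/-- The distance to `wstar` in the chart around `wstar.x`. -/
def chartDist (wstar w : PDPoint M l m) : ℝ := ‖w.chart E wstar.x - wstar.chart E wstar.x‖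

variable (E) in
/-- The filter of neighbourhoods of `wstar`, defined in the chart around `wstar.x`. -/
def chartNhds (wstar : PDPoint M l m) : Filter (PDPoint M l m) :=
  comap (PDPoint.chart E wstar.x) (𝓝 (wstar.chart E wstar.x)) ⊓
    𝓟 {w | w.x ∈ (extChartAt 𝓘(ℝ, E) wstar.x).source}

variable {wstar : PDPoint M l m}

lemma chartDist_nonneg (w : PDPoint M l m) : 0 ≤ chartDist E wstar w := norm_nonneg _

/-- The source condition is essential: off its source the chart carries no information about the
position of a point. -/
lemma eventually_chartNhds_iff {Q : PDPoint M l m → Prop} :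
    (∀ᶠ w in chartNhds E wstar, Q w) ↔ ∃ r > 0, ∀ w : PDPoint M l m,
      w.x ∈ (extChartAt 𝓘(ℝ, E) wstar.x).source → chartDist E wstar w < r → Q w := by
  have h := ((Metric.nhds_basis_ball (x := wstar.chart E wstar.x)).comap
    (PDPoint.chart (l := l) (m := m) E wstar.x)).inf_principal
    {w | w.x ∈ (extChartAt 𝓘(ℝ, E) wstar.x).source}
  refine h.eventually_iff.trans ?_
  simp only [Set.mem_inter_iff, Set.mem_preimage, mem_ball_iff_norm, and_imp, chartDist]
  exact exists_congr fun r ↦ and_congr_right fun _ ↦ forall_congr' fun w ↦ forall_comm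

lemma tendsto_chart_chartNhds :
    Tendsto (PDPoint.chart E wstar.x) (chartNhds E wstar) (𝓝 (wstar.chart E wstar.x)) :=
  tendsto_comap.mono_left inf_le_left

lemma eventually_source_chartNhds :
    ∀ᶠ w in chartNhds E wstar, w.x ∈ (extChartAt 𝓘(ℝ, E) wstar.x).source :=
  mem_inf_of_right (mem_principal_self _)

lemma tendsto_chartDist : Tendsto (chartDist E wstar) (chartNhds E wstar) (𝓝 0) := by
  have h := (tendsto_chart_chartNhds (E := E) (wstar := wstar)).sub_const (wstar.chart E wstar.x)
  rw [sub_self] at h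
  simpa [← chartDist.eq_1] using h.norm

lemma tendsto_x_chartNhds : Tendsto PDPoint.x (chartNhds E wstar) (𝓝 wstar.x) := by
  have h1 : Tendsto (fun w : PDPoint M l m ↦ (extChartAt 𝓘(ℝ, E) wstar.x).symm
      (w.chart E wstar.x).1) (chartNhds E wstar) (𝓝 wstar.x) := by
    have h2 := (continuousAt_extChartAt_symm (I := 𝓘(ℝ, E)) wstar.x).tendsto.comp
      ((continuous_fst.tendsto _).comp (tendsto_chart_chartNhds (E := E) (wstar := wstar)))
    rwa [extChartAt_to_inv] at h2
  refine h1.congr' ?_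
  filter_upwards [eventually_source_chartNhds] with w hw
  exact (extChartAt 𝓘(ℝ, E) wstar.x).left_inv hw

variable [RiemannianBundle (fun x : M ↦ TangentSpace 𝓘(ℝ, E) x)]
  [IsContMDiffRiemannianBundle 𝓘(ℝ, E) ∞ E (fun x : M ↦ TangentSpace 𝓘(ℝ, E) x)]
  {P : RCOP E M l m}

lemma RCOP.StandardAssumptions.kktField_eq_zero (h : P.StandardAssumptions wstar) :
    P.kktField wstar = 0 := by
  refine Prod.ext h.grad_eq_zero (Prod.ext ?_ (Prod.ext ?_ ?_))
  · ext i; exact h.h_eq_zero i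
  · ext i
    change P.g i wstar.x + wstar.s i = 0
    rw [h.slack i, add_neg_cancel]
  · ext i
    change wstar.z i * wstar.s i = 0
    rw [h.slack i, mul_neg, h.complementarity i, neg_zero]

lemma mem_target_chart (wstar : PDPoint M l m) :
    (wstar.chart E wstar.x).1 ∈ (extChartAt 𝓘(ℝ, E) wstar.x).target :=
  mem_extChartAt_target wstar.x

/-- A C¹ map is locally Lipschitz, and this one vanishes at the solution. -/
lemma RCOP.StandardAssumptions.eventually_kktChart_le (h : P.StandardAssumptions wstar) :
    ∃ C > 0, ∀ᶠ w in chartNhds E wstar,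
      ‖P.kktChart wstar.x (w.chart E wstar.x)‖ ≤ C * chartDist E wstar w := by
  obtain ⟨K, t, ht, hK⟩ := ((P.contDiffAt_kktChart (mem_target_chart wstar)).of_le
    one_le_two).exists_lipschitzOnWith
  refine ⟨K + 1, by positivity, ?_⟩
  have h0 : P.kktChart wstar.x (wstar.chart E wstar.x) = 0 := by
    rw [← P.tangentFlat_kktField (mem_extChartAt_source _), h.kktField_eq_zero, map_zero]
  filter_upwards [tendsto_chart_chartNhds ht] with w hw
  have h1 := hK.norm_sub_le hw (mem_of_mem_nhds ht)
  rw [h0, sub_zero] at h1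
  refine h1.trans ?_
  rw [chartDist]
  gcongr
  simp

/-- Evaluating the covector of `grad L` on the coordinates of `grad L` gives `‖grad L‖²`. This is at
most O(D) times `‖grad L‖`, and one factor cancels. -/
lemma RCOP.StandardAssumptions.eventually_gradL_le (h : P.StandardAssumptions wstar) :
    ∃ C > 0, ∀ᶠ w in chartNhds E wstar, ‖P.gradL w‖ ≤ C * chartDist E wstar w := by
  obtain ⟨C₁, hC₁, h₁⟩ := h.eventually_kktChart_le
  obtain ⟨C₂, hC₂, h₂⟩ := eventually_norm_chartCoord_le (E := E) wstar.x
  refine ⟨C₁ * C₂, by positivity, ?_⟩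
  filter_upwards [h₁, tendsto_x_chartNhds.eventually h₂, eventually_source_chartNhds]
    with w hw1 hw2 hws
  have h3 : chartFlat wstar.x w.x (P.gradL w) (chartCoord wstar.x w.x (P.gradL w)) =
      ‖P.gradL w‖ ^ 2 := by
    rw [chartFlat_apply, chartField_chartCoord hws, real_inner_self_eq_norm_sq]
  have h4 : ‖chartFlat wstar.x w.x (P.gradL w)‖ ≤ C₁ * chartDist E wstar w := by
    refine le_trans ?_ hw1
    rw [← P.tangentFlat_kktField hws]
    exact norm_fst_le (tangentFlat wstar.x w (P.kktField w))
  have h5 : ‖P.gradL w‖ ^ 2 ≤ C₁ * chartDist E wstar w * (C₂ * ‖P.gradL w‖) := by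
    rw [← h3]
    refine (Real.le_norm_self _).trans ((ContinuousLinearMap.le_opNorm _ _).trans ?_)
    have := chartDist_nonneg (E := E) (wstar := wstar) w
    gcongr
    exact hw2 _
  rcases (norm_nonneg (P.gradL w)).eq_or_lt with h6 | h6
  · rw [← h6]
    have := chartDist_nonneg (E := E) (wstar := wstar) w
    positivity
  · refine le_of_mul_le_mul_right ?_ h6
    linarith

lemma RCOP.StandardAssumptions.eventually_tangentNorm_le (h : P.StandardAssumptions wstar) :
    ∃ C > 0, ∀ᶠ w in chartNhds E wstar,
      tangentNorm (P.kktField w) ≤ C * chartDist E wstar w := by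
  obtain ⟨C₁, hC₁, h₁⟩ := h.eventually_kktChart_le
  obtain ⟨C₂, hC₂, h₂⟩ := h.eventually_gradL_le
  refine ⟨C₂ + C₁ + C₁ + C₁, by positivity, ?_⟩
  filter_upwards [h₁, h₂, eventually_source_chartNhds] with w hw1 hw2 hws
  rw [← P.tangentFlat_kktField hws] at hw1
  have h3 := (norm_snd_le (tangentFlat wstar.x w (P.kktField w))).trans hw1
  have e1 : ‖(P.kktField w).2.1‖ ≤ C₁ * chartDist E wstar w := (norm_fst_le _).trans h3
  have h4 := (norm_snd_le _).trans h3
  have e2 : ‖(P.kktField w).2.2.1‖ ≤ C₁ * chartDist E wstar w := (norm_fst_le _).trans h4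
  have e3 : ‖(P.kktField w).2.2.2‖ ≤ C₁ * chartDist E wstar w := (norm_snd_le _).trans h4
  have e0 : ‖(P.kktField w).1‖ ≤ C₂ * chartDist E wstar w := hw2
  rw [tangentNorm]
  refine Real.sqrt_le_iff.2 ⟨by have := chartDist_nonneg (E := E) (wstar := wstar) w; positivity, ?_⟩
  have n0 := norm_nonneg (P.kktField w).1
  have n1 := norm_nonneg (P.kktField w).2.1
  have n2 := norm_nonneg (P.kktField w).2.2.1
  have n3 := norm_nonneg (P.kktField w).2.2.2
  calc _ ≤ (‖(P.kktField w).1‖ + ‖(P.kktField w).2.1‖ + ‖(P.kktField w).2.2.1‖ +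
        ‖(P.kktField w).2.2.2‖) ^ 2 := by
        nlinarith [mul_nonneg n0 n1, mul_nonneg n0 n2, mul_nonneg n0 n3, mul_nonneg n1 n2,
          mul_nonneg n1 n3, mul_nonneg n2 n3]
    _ ≤ _ := by
        gcongr
        linarith

/-- In the chart, the covariant derivative of the KKT field is close to the Fréchet derivative. -/
lemma RCOP.StandardAssumptions.eventually_fderiv_sub_le (h : P.StandardAssumptions wstar) :
    ∃ C > 0, ∀ᶠ w in chartNhds E wstar, ∀ Δ : PDTangent E w,
      ‖fderiv ℝ (P.kktChart wstar.x) (w.chart E wstar.x) (tangentChart wstar.x w Δ) -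
        tangentFlat wstar.x w (P.covDerivKKT w Δ)‖ ≤
      C * chartDist E wstar w * ‖tangentChart wstar.x w Δ‖ := by
  let b := Module.finBasis ℝ E
  obtain ⟨C, hC, hb⟩ := b.exists_opNorm_le (F := ℝ)
  choose K hK hKx using fun i ↦ eventually_christoffel_bound (M := M) wstar.x (b i)
  obtain ⟨C₁, hC₁, h₁⟩ := h.eventually_gradL_le
  obtain ⟨C₂, hC₂, h₂⟩ := eventually_norm_chartCoord_le (E := E) wstar.x
  have hS : 0 ≤ ∑ i, K i := Finset.sum_nonneg fun i _ ↦ (hK i).le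
  refine ⟨C * ((∑ i, K i + 1) * (C₂ * C₁)), by positivity, ?_⟩
  filter_upwards [h₁, tendsto_x_chartNhds.eventually h₂, eventually_source_chartNhds,
    tendsto_x_chartNhds.eventually (eventually_all.2 hKx)] with w hw1 hw2 hws hwK Δ
  obtain ⟨e2, e1⟩ := P.fderiv_kktChart_sub hws Δ
  set Y := fderiv ℝ (P.kktChart wstar.x) (w.chart E wstar.x) (tangentChart wstar.x w Δ) -
        tangentFlat wstar.x w (P.covDerivKKT w Δ) with hY
  have hd := chartDist_nonneg (E := E) (wstar := wstar) w
  -- The difference is a pure Christoffel covector, linear in `grad L`; bounding it on a basis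
  -- supplies the factor D.
  have hnorm : ‖Y‖ = ‖Y.1‖ := by
    rw [Prod.norm_def, e2, norm_zero, max_eq_left (norm_nonneg _)]
  rw [hnorm, mul_assoc, mul_assoc]
  refine hb (by positivity) fun i ↦ ?_
  rw [e1, Real.norm_eq_abs]
  refine (hwK i _ _).trans ?_
  have h3 : ‖chartCoord wstar.x w.x (P.gradL w)‖ ≤ C₂ * (C₁ * chartDist E wstar w) :=
    (hw2 _).trans (by gcongr)
  have h4 : ‖chartCoord wstar.x w.x Δ.1‖ ≤ ‖tangentChart wstar.x w Δ‖ :=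
    norm_fst_le (tangentChart wstar.x w Δ)
  have h5 : K i ≤ ∑ i, K i + 1 := by
    linarith [Finset.single_le_sum (f := K) (fun i _ ↦ (hK i).le) (Finset.mem_univ i)]
  calc _ ≤ (∑ i, K i + 1) * ‖tangentChart wstar.x w Δ‖ * (C₂ * (C₁ * chartDist E wstar w)) := by
        gcongr
    _ = _ := by ring

lemma tangentChart_surjective {p : M} {w : PDPoint M l m}
    (hx : w.x ∈ (extChartAt 𝓘(ℝ, E) p).source) :
    Function.Surjective (tangentChart (E := E) p w) := fun δ ↦
  ⟨(chartField p δ.1 w.x, δ.2), Prod.ext (chartCoord_chartField hx δ.1) rfl⟩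

lemma tangentChart_injective {p : M} {w : PDPoint M l m}
    (hx : w.x ∈ (extChartAt 𝓘(ℝ, E) p).source) :
    Function.Injective (tangentChart (E := E) p w) := by
  rw [injective_iff_map_eq_zero]
  intro Δ hΔ
  refine Prod.ext ?_ congr(($hΔ).2)
  have h1 : chartCoord p w.x Δ.1 = 0 := congr(($hΔ).1)
  rw [← chartField_chartCoord hx Δ.1, h1]
  exact map_zero _

/-- At the solution `grad L = 0` kills the Christoffel term, so Fréchet and covariant derivatives
agree there. -/
lemma RCOP.StandardAssumptions.injective_fderiv (h : P.StandardAssumptions wstar) :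
    Function.Injective (fderiv ℝ (P.kktChart wstar.x) (wstar.chart E wstar.x)) := by
  have hx := mem_extChartAt_source (I := 𝓘(ℝ, E)) wstar.x
  rw [injective_iff_map_eq_zero]
  intro δ hδ
  obtain ⟨Δ, rfl⟩ := tangentChart_surjective hx δ
  obtain ⟨e2, e1⟩ := P.fderiv_kktChart_sub hx Δ
  rw [hδ, zero_sub] at e1 e2
  have h1 : tangentFlat wstar.x wstar (P.covDerivKKT wstar Δ) = 0 := by
    refine neg_eq_zero.1 (Prod.ext ?_ e2)
    ext v
    rw [e1, h.grad_eq_zero, inner_zero_left]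
    rfl
  have h2 := (injective_iff_map_eq_zero _).1 (tangentFlat_injective hx) _ h1
  rw [(injective_iff_map_eq_zero _).1 h.injective_covDerivKKT _ h2, map_zero]

lemma eventually_norm_apply_sub_le {V W : Type*} [NormedAddCommGroup V] [NormedSpace ℝ V]
    [NormedAddCommGroup W] [NormedSpace ℝ W] {A : V → V →L[ℝ] W} {a : V} (hA : ContinuousAt A a)
    {ε : ℝ} (hε : 0 < ε) : ∀ᶠ x in 𝓝 a, ∀ v, ‖A x v - A a v‖ ≤ ε * ‖v‖ := by
  filter_upwards [hA.eventually (Metric.ball_mem_nhds _ hε)] with x hx v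
  exact ContinuousLinearMap.le_of_opNorm_le (A x - A a) (mem_ball_iff_norm.1 hx).le v

/-- Uniform nonsingularity of the covariant derivative of the KKT field near a solution. -/
lemma RCOP.StandardAssumptions.eventually_norm_le_covDeriv (h : P.StandardAssumptions wstar) :
    ∃ c > 0, ∀ᶠ w in chartNhds E wstar, ∀ Δ : PDTangent E w,
      c * ‖tangentChart wstar.x w Δ‖ ≤ ‖tangentFlat wstar.x w (P.covDerivKKT w Δ)‖ := by
  obtain ⟨c, hc, h0⟩ := LinearMap.exists_pos_mul_norm_le
    (fderiv ℝ (P.kktChart wstar.x) (wstar.chart E wstar.x)).toLinearMap h.injective_fderiv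
  obtain ⟨C, hC, h1⟩ := h.eventually_fderiv_sub_le
  have hcont : ContinuousAt (fderiv ℝ (P.kktChart wstar.x)) (wstar.chart E wstar.x) :=
    (P.contDiffAt_kktChart (mem_target_chart wstar)).continuousAt_fderiv (by simp)
  -- Two perturbations, moving the base point and replacing the Fréchet by the covariant derivative,
  -- cost `c / 4` each and leave `c / 2`.
  have h2 := tendsto_chart_chartNhds.eventually
    (eventually_norm_apply_sub_le hcont (by positivity : 0 < c / 4))
  have h4 : ∀ᶠ w in chartNhds E wstar, C * chartDist E wstar w < c / 4 := by
    have h5 := (tendsto_chartDist (E := E) (wstar := wstar)).const_mul C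
    rw [mul_zero] at h5
    exact h5.eventually (gt_mem_nhds (by positivity))
  refine ⟨c / 2, by positivity, ?_⟩
  filter_upwards [h1, h2, h4] with w hw1 hw2 hw4 Δ
  set δ := tangentChart wstar.x w Δ
  have e0 : c * ‖δ‖ ≤ ‖fderiv ℝ (P.kktChart wstar.x) (wstar.chart E wstar.x) δ‖ := h0 δ
  have e1 := hw1 Δ
  have e2 := hw2 δ
  have e3 : C * chartDist E wstar w * ‖δ‖ ≤ c / 4 * ‖δ‖ := by gcongr
  have e4 := norm_sub_norm_le (fderiv ℝ (P.kktChart wstar.x) (wstar.chart E wstar.x) δ)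
    (fderiv ℝ (P.kktChart wstar.x) (w.chart E wstar.x) δ)
  rw [norm_sub_rev] at e4
  have e5 := norm_sub_norm_le (fderiv ℝ (P.kktChart wstar.x) (w.chart E wstar.x) δ)
    (tangentFlat wstar.x w (P.covDerivKKT w Δ))
  linarith

lemma RCOP.StandardAssumptions.eventually_bijective (h : P.StandardAssumptions wstar) :
    ∀ᶠ w in chartNhds E wstar, Function.Bijective (P.covDerivKKT w) := by
  obtain ⟨c, hc, h0⟩ := h.eventually_norm_le_covDeriv
  filter_upwards [h0, eventually_source_chartNhds] with w hw hws
  have hinj : Function.Injective (P.covDerivKKT w) := by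
    rw [injective_iff_map_eq_zero]
    intro Δ hΔ
    have h1 := hw Δ
    rw [hΔ, map_zero, norm_zero] at h1
    refine (injective_iff_map_eq_zero _).1 (tangentChart_injective hws) Δ ?_
    exact norm_le_zero_iff.1 (nonpos_of_mul_nonpos_right h1 hc)
  exact ⟨hinj, LinearMap.injective_iff_surjective.1 hinj⟩

/-- The perturbed Newton step, in the chart. -/
lemma RCOP.StandardAssumptions.eventually_newton (h : P.StandardAssumptions wstar) :
    ∃ C > 0, ∀ᶠ w in chartNhds E wstar, ∀ (μ : ℝ) (Δ : PDTangent E w), 0 ≤ μ → P.NewtonEq w μ Δ →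
      ‖w.chart E wstar.x + tangentChart wstar.x w Δ - wstar.chart E wstar.x‖ ≤
        C * (chartDist E wstar w ^ 2 + μ) := by
  obtain ⟨c, hc, h0⟩ := h.eventually_norm_le_covDeriv
  obtain ⟨C, hC, h1⟩ := h.eventually_fderiv_sub_le
  obtain ⟨C', hC', r, hr, h2⟩ :=
    (P.contDiffAt_kktChart (mem_target_chart wstar)).exists_quadratic_bound
  let e : ChartDual E l m := (0, 0, 0, WithLp.toLp 2 fun _ ↦ 1)
  have hk : P.kktChart wstar.x (wstar.chart E wstar.x) = 0 := by
    rw [← P.tangentFlat_kktField (mem_extChartAt_source _), h.kktField_eq_zero, map_zero]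
  refine ⟨(C' + C + ‖e‖) / c, by positivity, ?_⟩
  filter_upwards [h0, h1, tendsto_chart_chartNhds.eventually (Metric.ball_mem_nhds _ hr),
    eventually_source_chartNhds] with w hw0 hw1 hwr hws μ Δ hμ hN
  -- `Δ'` represents the current error, so the error after the step is `Δ + Δ'` in coordinates and
  -- the lower bound for the covariant derivative applies to it.
  obtain ⟨Δ', hΔ'⟩ := tangentChart_surjective hws (w.chart E wstar.x - wstar.chart E wstar.x)
  have e1 := hw0 (Δ + Δ')
  have e2 : w.chart E wstar.x + tangentChart wstar.x w Δ - wstar.chart E wstar.x =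
      tangentChart wstar.x w (Δ + Δ') := by
    rw [map_add, hΔ']
    abel
  have e3 := (h2 _ hwr _ (Metric.mem_ball_self hr)).1
  rw [hk, zero_sub] at e3
  have e4 := hw1 Δ'
  rw [hΔ'] at e4
  have e5 : tangentFlat wstar.x w (P.covDerivKKT w Δ) =
      -P.kktChart wstar.x (w.chart E wstar.x) + μ • e := by
    rw [hN, map_add, map_neg, map_smul, P.tangentFlat_kktField hws]
    congr 2
    exact Prod.ext (map_zero (chartFlat wstar.x w.x)) rfl
  -- Taylor remainder at `w*`, minus the Christoffel error along `Δ'`, plus the barrier term: of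
  -- orders D², D² and μ.
  have e6 : tangentFlat wstar.x w (P.covDerivKKT w (Δ + Δ')) =
      (-P.kktChart wstar.x (w.chart E wstar.x) - fderiv ℝ (P.kktChart wstar.x) (w.chart E wstar.x)
        (wstar.chart E wstar.x - w.chart E wstar.x)) -
      (fderiv ℝ (P.kktChart wstar.x) (w.chart E wstar.x)
        (w.chart E wstar.x - wstar.chart E wstar.x) - tangentFlat wstar.x w (P.covDerivKKT w Δ')) +
      μ • e := by
    rw [map_add, map_add, e5, ← neg_sub (w.chart E wstar.x), map_neg]
    abel
  rw [← norm_neg (wstar.chart E wstar.x - w.chart E wstar.x), neg_sub] at e3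
  have e7 : ‖tangentFlat wstar.x w (P.covDerivKKT w (Δ + Δ'))‖ ≤
      C' * chartDist E wstar w ^ 2 + C * chartDist E wstar w * chartDist E wstar w + μ * ‖e‖ := by
    rw [e6]
    refine (norm_add_le _ _).trans (add_le_add ((norm_sub_le _ _).trans (add_le_add e3 e4)) ?_)
    rw [norm_smul, Real.norm_of_nonneg hμ]
  rw [e2, div_mul_eq_mul_div, le_div_iff₀ hc]
  have := chartDist_nonneg (E := E) (wstar := wstar) w
  have := mul_nonneg hC'.le hμ
  have := mul_nonneg hC.le hμ
  have := mul_nonneg (norm_nonneg e) (sq_nonneg (chartDist E wstar w))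
  nlinarith

end LocalModel

/-! ### The retraction in coordinates. -/

section Retraction

variable {E : Type*} [NormedAddCommGroup E] [NormedSpace ℝ E] [FiniteDimensional ℝ E]
  {M : Type*} [MetricSpace M] [ChartedSpace E M] [IsManifold 𝓘(ℝ, E) ∞ M]
  {l m : ℕ} {R : (x : M) → TangentSpace 𝓘(ℝ, E) x → M} {wstar : PDPoint M l m}

/-- The coordinates of tangent vectors given by the chart of the tangent bundle. -/
def tangentCoord (p : M) : PartialEquiv (TangentBundle 𝓘(ℝ, E) M) (E × E) :=
  extChartAt 𝓘(ℝ, E).tangent (⟨p, 0⟩ : TangentBundle 𝓘(ℝ, E) M)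

lemma tangentCoord_apply {p x : M} (hx : x ∈ (extChartAt 𝓘(ℝ, E) p).source)
    (ξ : TangentSpace 𝓘(ℝ, E) x) :
    tangentCoord p ⟨x, ξ⟩ = (extChartAt 𝓘(ℝ, E) p x, chartCoord p x ξ) := by
  have hx' : x ∈ (trivializationAt E (TangentSpace 𝓘(ℝ, E) : M → Type _) p).baseSet := by
    simpa using hx
  have h2 : chartCoord p x ξ = (trivializationAt E (TangentSpace 𝓘(ℝ, E)) p ⟨x, ξ⟩).2 := by
    rw [chartCoord, Trivialization.continuousLinearMapAt_apply,
      Trivialization.coe_linearMapAt_of_mem _ hx']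
  rw [h2]
  rfl

lemma tangentCoord_symm {p x : M} (hx : x ∈ (extChartAt 𝓘(ℝ, E) p).source)
    (ξ : TangentSpace 𝓘(ℝ, E) x) :
    (tangentCoord p).symm (extChartAt 𝓘(ℝ, E) p x, chartCoord p x ξ) = ⟨x, ξ⟩ := by
  rw [← tangentCoord_apply hx]
  refine (tangentCoord p).left_inv ?_
  rw [tangentCoord, extChartAt_source]
  exact (TangentBundle.mem_chart_source_iff _ _).2 (by simpa using hx)

/-- The retraction in the chart around `p`. -/
def retractChart (R : (x : M) → TangentSpace 𝓘(ℝ, E) x → M) (p : M) (a : E × E) : E :=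
  extChartAt 𝓘(ℝ, E) p
    (R ((tangentCoord (E := E) p).symm a).proj ((tangentCoord (E := E) p).symm a).snd)

lemma retractChart_apply {p x : M} (hx : x ∈ (extChartAt 𝓘(ℝ, E) p).source)
    (ξ : TangentSpace 𝓘(ℝ, E) x) :
    retractChart R p (extChartAt 𝓘(ℝ, E) p x, chartCoord p x ξ) =
      extChartAt 𝓘(ℝ, E) p (R x ξ) := by
  rw [retractChart, tangentCoord_symm hx]

lemma IsRetraction.contMDiffAt_comp_tangentCoord (hR : IsRetraction E R) (p : M) :
    ContMDiffAt 𝓘(ℝ, E × E) 𝓘(ℝ, E) ∞ (fun a : E × E ↦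
      R ((tangentCoord (E := E) p).symm a).proj ((tangentCoord (E := E) p).symm a).snd)
      (extChartAt 𝓘(ℝ, E) p p, 0) := by
  have h0 : (extChartAt 𝓘(ℝ, E) p p, (0 : E)) =
      extChartAt 𝓘(ℝ, E).tangent (⟨p, 0⟩ : TangentBundle 𝓘(ℝ, E) M) ⟨p, 0⟩ := by
    have h := tangentCoord_apply (mem_extChartAt_source (I := 𝓘(ℝ, E)) p) 0
    rw [_root_.map_zero] at h
    exact h.symm
  have h1 : ContMDiffAt 𝓘(ℝ, E × E) 𝓘(ℝ, E).tangent ∞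
      (extChartAt 𝓘(ℝ, E).tangent (⟨p, 0⟩ : TangentBundle 𝓘(ℝ, E) M)).symm
      (extChartAt 𝓘(ℝ, E) p p, (0 : E)) := by
    rw [h0]
    exact (contMDiffOn_extChartAt_symm (n := ∞) _).contMDiffAt (extChartAt_target_mem_nhds _)
  exact hR.smooth.contMDiffAt.comp _ h1

lemma tangentCoord_symm_zero (p : M) :
    (tangentCoord (E := E) p).symm (extChartAt 𝓘(ℝ, E) p p, 0) = ⟨p, 0⟩ := by
  have h := tangentCoord_symm (mem_extChartAt_source (I := 𝓘(ℝ, E)) p) 0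
  rwa [map_zero] at h

lemma IsRetraction.contDiffAt_retractChart (hR : IsRetraction E R) (p : M) :
    ContDiffAt ℝ ∞ (retractChart R p) (extChartAt 𝓘(ℝ, E) p p, 0) := by
  rw [← contMDiffAt_iff_contDiffAt]
  refine ContMDiffAt.comp _ ?_ (hR.contMDiffAt_comp_tangentCoord p)
  rw [tangentCoord_symm_zero]
  change ContMDiffAt 𝓘(ℝ, E) 𝓘(ℝ, E) ∞ (extChartAt 𝓘(ℝ, E) p) (R p 0)
  rw [hR.map_zero]
  exact contMDiffAt_extChartAt

/-- Along the fibre the map is chart ∘ `R x` ∘ (inverse chart differential), and the outer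
differentials cancel because that of `R x` at zero is the identity. -/
lemma IsRetraction.fderiv_retractChart (hR : IsRetraction E R) {p x : M}
    (hx : x ∈ (extChartAt 𝓘(ℝ, E) p).source)
    (hd : DifferentiableAt ℝ (retractChart R p) (extChartAt 𝓘(ℝ, E) p x, 0)) (v : E) :
    fderiv ℝ (retractChart R p) (extChartAt 𝓘(ℝ, E) p x, 0) (0, v) = v := by
  let L : E →L[ℝ] E := (trivializationAt E (TangentSpace 𝓘(ℝ, E)) p).symmL ℝ x
  have hL : ∀ v, L v = chartField p v x := fun v ↦ rfl
  have h1 : HasFDerivAt (fun v : E ↦ retractChart R p (extChartAt 𝓘(ℝ, E) p x, v))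
      ((fderiv ℝ (retractChart R p) (extChartAt 𝓘(ℝ, E) p x, 0)).comp
        (ContinuousLinearMap.inr ℝ E E)) 0 := by
    have h2 : HasFDerivAt (fun v : E ↦ (extChartAt 𝓘(ℝ, E) p x, v))
      (ContinuousLinearMap.inr ℝ E E) 0 := hasFDerivAt_prodMk_right _ _
    exact HasFDerivAt.comp (f := fun v : E ↦ (extChartAt 𝓘(ℝ, E) p x, v)) 0 hd.hasFDerivAt h2
  have h3 : (fun v : E ↦ retractChart R p (extChartAt 𝓘(ℝ, E) p x, v)) =
      (extChartAt 𝓘(ℝ, E) p) ∘ (fun v : E ↦ R x v) ∘ L := by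
    ext v
    have h := retractChart_apply (R := R) hx (chartField p v x)
    rw [chartCoord_chartField hx] at h
    exact h
  have hL0 : L 0 = 0 := _root_.map_zero L
  have hRL : R x (L 0) = x := (congrArg (fun v : E ↦ R x v) hL0).trans (hR.map_zero x)
  -- `R x (L 0) = x` is not definitional, so derivatives are stated at any `y` equal to `x`.
  have h4 : ∀ y, y = x → HasMFDerivAt 𝓘(ℝ, E) 𝓘(ℝ, E) (extChartAt 𝓘(ℝ, E) p) y
      (mfderiv 𝓘(ℝ, E) 𝓘(ℝ, E) (extChartAt 𝓘(ℝ, E) p) y) := by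
    rintro y rfl
    exact (mdifferentiableAt_extChartAt (by simpa using hx)).hasMFDerivAt
  have h5 : ∀ u : E, u = 0 → HasMFDerivAt 𝓘(ℝ, E) 𝓘(ℝ, E) (fun v : E ↦ R x v) u
      (ContinuousLinearMap.id ℝ E) := by
    rintro u rfl
    exact hR.hasMFDerivAt_zero x
  have h6 : HasMFDerivAt 𝓘(ℝ, E) 𝓘(ℝ, E) L 0 L := L.hasMFDerivAt
  have h7 := ((h4 _ hRL).comp (L 0) (h5 _ hL0)).comp (0 : E) h6
  rw [hasMFDerivAt_iff_hasFDerivAt] at h7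
  rw [h3] at h1
  have h8 := h1.unique h7
  have h9 : fderiv ℝ (retractChart R p) (extChartAt 𝓘(ℝ, E) p x, 0) (0, v) =
      mfderiv 𝓘(ℝ, E) 𝓘(ℝ, E) (extChartAt 𝓘(ℝ, E) p) (R x (L 0)) (L v) := congr($h8 v)
  have h10 : ∀ y, y = x → (mfderiv 𝓘(ℝ, E) 𝓘(ℝ, E) (extChartAt 𝓘(ℝ, E) p) y :
      E →L[ℝ] E) (L v) = v := by
    rintro y rfl
    rw [← chartCoord_eq_mfderiv hx]
    exact chartCoord_chartField hx v
  rw [h9]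
  exact h10 _ hRL

/-- The retraction on `N`, in the chart, is a first-order approximation of the translation. -/
lemma IsRetraction.eventually_retract (hR : IsRetraction E R) (wstar : PDPoint M l m) :
    ∃ C > 0, ∃ r > 0, ∀ᶠ w in chartNhds E wstar, ∀ Δ : PDTangent E w,
      ‖tangentChart wstar.x w Δ‖ < r →
      (retract R w Δ).x ∈ (extChartAt 𝓘(ℝ, E) wstar.x).source ∧
      ‖(retract R w Δ).chart E wstar.x - (w.chart E wstar.x + tangentChart wstar.x w Δ)‖ ≤
        C * ‖tangentChart wstar.x w Δ‖ ^ 2 := by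
  set p := wstar.x
  have hsm := (hR.contDiffAt_retractChart p).of_le (m := 2) ENat.LEInfty.out
  obtain ⟨C, hC, r₁, hr₁, h1⟩ := hsm.exists_quadratic_bound
  have h2 : ∀ᶠ a in 𝓝 (extChartAt 𝓘(ℝ, E) p p, (0 : E)),
      R ((tangentCoord (E := E) p).symm a).proj ((tangentCoord (E := E) p).symm a).snd ∈
        (extChartAt 𝓘(ℝ, E) p).source ∧ DifferentiableAt ℝ (retractChart R p) a := by
    refine Filter.Eventually.and ?_ ((hsm.eventually (by simp)).mono fun a ha ↦
      ha.differentiableAt (by simp))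
    refine (hR.contMDiffAt_comp_tangentCoord p).continuousAt.eventually_mem ?_
    rw [tangentCoord_symm_zero]
    change _ ∈ 𝓝 (R p 0)
    rw [hR.map_zero]
    exact extChartAt_source_mem_nhds p
  obtain ⟨r₂, hr₂, h2⟩ := Metric.eventually_nhds_iff_ball.1 h2
  refine ⟨C, hC, min r₁ r₂, by positivity, ?_⟩
  have h3 : ∀ᶠ w in chartNhds E wstar, ‖extChartAt 𝓘(ℝ, E) p w.x - extChartAt 𝓘(ℝ, E) p p‖ <
      min r₁ r₂ := by
    filter_upwards [(tendsto_chartDist (E := E) (wstar := wstar)).eventually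
      (gt_mem_nhds (by positivity : 0 < min r₁ r₂))] with w hw
    exact (norm_fst_le (w.chart E p - wstar.chart E p)).trans_lt hw
  filter_upwards [h3, eventually_source_chartNhds] with w hw hws Δ hΔ
  have hΔ1 : ‖chartCoord p w.x Δ.1‖ ≤ ‖tangentChart p w Δ‖ := norm_fst_le (tangentChart p w Δ)
  have hball : ∀ v : E, ‖v‖ < min r₁ r₂ →
      (extChartAt 𝓘(ℝ, E) p w.x, v) ∈ Metric.ball (extChartAt 𝓘(ℝ, E) p p, (0 : E)) (min r₁ r₂) := by
    intro v hv
    rw [mem_ball_iff_norm, Prod.norm_def, max_lt_iff]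
    exact ⟨hw, by simpa using hv⟩
  have hb0 := hball 0 (by rw [norm_zero]; positivity)
  have hb1 := hball _ (hΔ1.trans_lt hΔ)
  have hsub1 := Metric.ball_subset_ball (x := (extChartAt 𝓘(ℝ, E) p p, (0 : E))) (min_le_left r₁ r₂)
  have hsub2 := Metric.ball_subset_ball (x := (extChartAt 𝓘(ℝ, E) p p, (0 : E))) (min_le_right r₁ r₂)
  have hsrc := (h2 _ (hsub2 hb1)).1
  rw [tangentCoord_symm hws] at hsrc
  refine ⟨hsrc, ?_⟩
  -- Taylor expansion from `(x, 0)` to `(x, Δx)` with locally uniform constant. The linear term is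
  -- `Δx` itself, and the Euclidean components are translated exactly.
  have h4 := (h1 _ (hsub1 hb0) _ (hsub1 hb1)).1
  have h5 : retractChart R p (extChartAt 𝓘(ℝ, E) p w.x, 0) = extChartAt 𝓘(ℝ, E) p w.x := by
    have h := retractChart_apply (R := R) hws 0
    rwa [_root_.map_zero, hR.map_zero] at h
  rw [retractChart_apply hws, h5, Prod.mk_sub_mk, sub_self, sub_zero,
    hR.fderiv_retractChart hws (h2 _ (hsub2 hb0)).2] at h4
  have h6 : (retract R w Δ).chart E p - (w.chart E p + tangentChart p w Δ) =
      (extChartAt 𝓘(ℝ, E) p (R w.x Δ.1) - extChartAt 𝓘(ℝ, E) p w.x - chartCoord p w.x Δ.1, 0) := by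
    refine Prod.ext (sub_add_eq_sub_sub _ _ _) (sub_eq_zero.2 rfl)
  have h7 : ‖((0 : E), chartCoord p w.x Δ.1)‖ = ‖chartCoord p w.x Δ.1‖ := by
    rw [Prod.norm_def, norm_zero, max_eq_right (norm_nonneg _)]
  rw [h6, Prod.norm_def, norm_zero, max_eq_left (norm_nonneg _)]
  refine h4.trans ?_
  rw [h7]
  gcongr

end Retraction

/-! ### Equivalence of the product distance and the chart distance. -/

section Distance

variable {E : Type*} [NormedAddCommGroup E] [NormedSpace ℝ E] [FiniteDimensional ℝ E]
  {M : Type*} [MetricSpace M] [ChartedSpace E M] [IsManifold 𝓘(ℝ, E) ∞ M]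
  [RiemannianBundle (fun x : M ↦ TangentSpace 𝓘(ℝ, E) x)]
  [IsContMDiffRiemannianBundle 𝓘(ℝ, E) ∞ E (fun x : M ↦ TangentSpace 𝓘(ℝ, E) x)]
  [IsRiemannianManifold 𝓘(ℝ, E) M] {l m : ℕ}

lemma PDPoint.dist_nonneg (w w' : PDPoint M l m) : 0 ≤ w.dist w' := Real.sqrt_nonneg _

lemma PDPoint.dist_components_le (w w' : PDPoint M l m) :
    Dist.dist w.x w'.x ≤ w.dist w' ∧ ‖w.y - w'.y‖ ≤ w.dist w' ∧ ‖w.z - w'.z‖ ≤ w.dist w' ∧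
      ‖w.s - w'.s‖ ≤ w.dist w' := by
  unfold PDPoint.dist
  refine ⟨Real.le_sqrt_of_sq_le ?_, Real.le_sqrt_of_sq_le ?_, Real.le_sqrt_of_sq_le ?_,
    Real.le_sqrt_of_sq_le ?_⟩ <;>
  nlinarith [sq_nonneg (Dist.dist w.x w'.x), sq_nonneg ‖w.y - w'.y‖, sq_nonneg ‖w.z - w'.z‖,
    sq_nonneg ‖w.s - w'.s‖]

lemma PDPoint.dist_le_add (w w' : PDPoint M l m) :
    w.dist w' ≤ Dist.dist w.x w'.x + ‖w.y - w'.y‖ + ‖w.z - w'.z‖ + ‖w.s - w'.s‖ := by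
  have n0 : 0 ≤ Dist.dist w.x w'.x := _root_.dist_nonneg
  have n1 := norm_nonneg (w.y - w'.y)
  have n2 := norm_nonneg (w.z - w'.z)
  have n3 := norm_nonneg (w.s - w'.s)
  refine Real.sqrt_le_iff.2 ⟨by positivity, ?_⟩
  nlinarith [mul_nonneg n0 n1, mul_nonneg n0 n2, mul_nonneg n0 n3, mul_nonneg n1 n2,
    mul_nonneg n1 n3, mul_nonneg n2 n3]

/-- The Riemannian distance to `wstar` is equivalent to the distance in the chart. -/
lemma eventually_dist_equiv (wstar : PDPoint M l m) : ∃ C > 0, ∀ᶠ w in chartNhds E wstar,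
    w.dist wstar ≤ C * chartDist E wstar w ∧ chartDist E wstar w ≤ C * w.dist wstar := by
  obtain ⟨C₁, hC₁, h1⟩ := eventually_dist_le_chart (E := E) wstar.x
  obtain ⟨C₂, hC₂, h2⟩ := eventually_chart_le_dist (E := E) wstar.x
  refine ⟨C₁ + C₂ + 3, by positivity, ?_⟩
  filter_upwards [tendsto_x_chartNhds.eventually h1, tendsto_x_chartNhds.eventually h2]
    with w hw1 hw2
  have hD := chartDist_nonneg (E := E) (wstar := wstar) w
  have hd := w.dist_nonneg wstar
  constructor
  · have e0 : ‖extChartAt 𝓘(ℝ, E) wstar.x w.x - extChartAt 𝓘(ℝ, E) wstar.x wstar.x‖ ≤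
        chartDist E wstar w := norm_fst_le (w.chart E wstar.x - wstar.chart E wstar.x)
    have e := norm_snd_le (w.chart E wstar.x - wstar.chart E wstar.x)
    have e1 : ‖w.y - wstar.y‖ ≤ chartDist E wstar w := (norm_fst_le _).trans e
    have e' := (norm_snd_le _).trans e
    have e2 : ‖w.z - wstar.z‖ ≤ chartDist E wstar w := (norm_fst_le _).trans e'
    have e3 : ‖w.s - wstar.s‖ ≤ chartDist E wstar w := (norm_snd_le _).trans e'
    have e4 := mul_le_mul_of_nonneg_left e0 hC₁.le
    nlinarith [w.dist_le_add wstar]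
  · obtain ⟨e0, e1, e2, e3⟩ := w.dist_components_le wstar
    have e4 : w.dist wstar ≤ (C₁ + C₂ + 3) * w.dist wstar := by nlinarith
    have e5 : C₂ * Dist.dist w.x wstar.x ≤ (C₁ + C₂ + 3) * w.dist wstar := by
      gcongr
      linarith
    change max _ (max _ (max _ _)) ≤ _
    exact max_le (hw2.trans e5) (max_le (e1.trans e4) (max_le (e2.trans e4) (e3.trans e4)))

/-- Converts chart neighbourhoods into balls for the product distance, the form in which the
starting radius is required. -/
lemma exists_dist_lt_of_eventually {wstar : PDPoint M l m} {Q : PDPoint M l m → Prop}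
    (hQ : ∀ᶠ w in chartNhds E wstar, Q w) : ∃ δ > 0, ∀ w : PDPoint M l m, w.dist wstar < δ → Q w := by
  obtain ⟨r, hr, h⟩ := eventually_chartNhds_iff.1 hQ
  have h1 : ∀ᶠ x in 𝓝 wstar.x, x ∈ (extChartAt 𝓘(ℝ, E) wstar.x).source ∧
      extChartAt 𝓘(ℝ, E) wstar.x x ∈ Metric.ball (extChartAt 𝓘(ℝ, E) wstar.x wstar.x) r :=
    (eventually_mem_source (mem_extChartAt_source _)).and
      ((continuousAt_extChartAt wstar.x).eventually_mem (Metric.ball_mem_nhds _ hr))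
  obtain ⟨ε, hε, h1⟩ := Metric.eventually_nhds_iff.1 h1
  refine ⟨min ε r, by positivity, fun w hw ↦ ?_⟩
  obtain ⟨e0, e1, e2, e3⟩ := w.dist_components_le wstar
  obtain ⟨hws, hwr⟩ := h1 (e0.trans_lt (hw.trans_le (min_le_left ε r)))
  have hr' := hw.trans_le (min_le_right ε r)
  refine h w hws ?_
  change max _ (max _ (max _ _)) < _
  exact max_lt (mem_ball_iff_norm.1 hwr) (max_lt (e1.trans_lt hr')
    (max_lt (e2.trans_lt hr') (e3.trans_lt hr')))

end Distance

/-! ### Uniform bounds for the barrier rule. -/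

section BarrierRule

/-- Uniform linear bounds for a barrier rule. -/
lemma exists_linear_bound {θ : ℕ → ℝ → ℝ} (hθ : ∀ k, θ k =O[𝓝[≥] 0] fun t : ℝ ↦ t)
    (h : (fun p : ℕ × ℝ ↦ θ p.1 p.2) =o[atTop ×ˢ 𝓝[≥] 0] (fun p : ℕ × ℝ ↦ p.2))
    {ε : ℝ} (hε : 0 < ε) :
    ∃ K : ℕ, ∃ c > 0, ∃ t₀ > 0, ∀ k t, 0 ≤ t → t < t₀ →
      θ k t ≤ c * t ∧ (K ≤ k → θ k t ≤ ε * t) := by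
  -- The joint limit covers all `k ≥ K` on one interval of `t`; the finitely many earlier indices
  -- use their individual linear bounds, whose constants are summed.
  obtain ⟨pa, ha, pb, hb, hab⟩ := eventually_prod_iff.1 (h.def hε)
  obtain ⟨K, hK⟩ := eventually_atTop.1 ha
  choose c hc using fun k ↦ (hθ k).bound
  have hfin : ∀ᶠ t in 𝓝[≥] (0 : ℝ), ∀ k ∈ Finset.range K, ‖θ k t‖ ≤ c k * ‖t‖ :=
    (Filter.eventually_all_finset _).2 fun k _ ↦ hc k
  obtain ⟨t₀, ht₀, hsub⟩ := mem_nhdsGE_iff_exists_Ico_subset.1 (hb.and hfin)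
  have hsum : 0 ≤ ∑ k ∈ Finset.range K, |c k| := Finset.sum_nonneg fun k _ ↦ abs_nonneg _
  refine ⟨K, ε + ∑ k ∈ Finset.range K, |c k|, by positivity, t₀, ht₀, fun k t ht htt ↦ ?_⟩
  obtain ⟨h1, h2⟩ := hsub ⟨ht, htt⟩
  have h3 : K ≤ k → θ k t ≤ ε * t := fun hk ↦ by
    have := hab (hK k hk) h1
    rw [Real.norm_of_nonneg ht] at this
    exact (Real.le_norm_self _).trans this
  refine ⟨?_, h3⟩
  rcases le_or_gt K k with hk | hk
  · exact (h3 hk).trans (by gcongr; linarith)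
  · have h4 := h2 k (Finset.mem_range.2 hk)
    rw [Real.norm_of_nonneg ht] at h4
    have h5 : |c k| ≤ ∑ k ∈ Finset.range K, |c k| :=
      Finset.single_le_sum (f := fun k ↦ |c k|) (fun k _ ↦ abs_nonneg _) (Finset.mem_range.2 hk)
    refine ((Real.le_norm_self _).trans h4).trans ?_
    gcongr
    linarith [le_abs_self (c k)]

/-- Lets the quadratic case reuse the convergence argument of the superlinear one. -/
lemma isLittleO_of_isBigO_sq {θ : ℕ → ℝ → ℝ}
    (h : (fun p : ℕ × ℝ ↦ θ p.1 p.2) =O[atTop ×ˢ 𝓝[≥] 0] (fun p : ℕ × ℝ ↦ p.2 ^ 2)) :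
    (fun p : ℕ × ℝ ↦ θ p.1 p.2) =o[atTop ×ˢ 𝓝[≥] 0] (fun p : ℕ × ℝ ↦ p.2) := by
  have h0 : Tendsto (fun p : ℕ × ℝ ↦ p.2) (atTop ×ˢ 𝓝[≥] 0) (𝓝 0) :=
    (tendsto_snd (f := (atTop : Filter ℕ)) (g := 𝓝[≥] (0 : ℝ))).mono_right nhdsWithin_le_nhds
  exact h.trans_isLittleO ((isLittleO_pow_id one_lt_two).comp_tendsto h0)

end BarrierRule

/-! ### Error recursion for one step. -/

section Step

variable {E : Type*} [NormedAddCommGroup E] [NormedSpace ℝ E] [FiniteDimensional ℝ E]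
  {M : Type*} [MetricSpace M] [ChartedSpace E M] [IsManifold 𝓘(ℝ, E) ∞ M]
  [RiemannianBundle (fun x : M ↦ TangentSpace 𝓘(ℝ, E) x)]
  [IsContMDiffRiemannianBundle 𝓘(ℝ, E) ∞ E (fun x : M ↦ TangentSpace 𝓘(ℝ, E) x)]
  {l m : ℕ} {P : RCOP E M l m} {R : (x : M) → TangentSpace 𝓘(ℝ, E) x → M}
  {wstar : PDPoint M l m}

lemma abs_sub_le_chartDist (w : PDPoint M l m) (i : Fin m) :
    |w.z i - wstar.z i| ≤ chartDist E wstar w ∧ |w.s i - wstar.s i| ≤ chartDist E wstar w := by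
  have e := (norm_snd_le _).trans (norm_snd_le (w.chart E wstar.x - wstar.chart E wstar.x))
  have e2 : ‖w.z - wstar.z‖ ≤ chartDist E wstar w := (norm_fst_le _).trans e
  have e3 : ‖w.s - wstar.s‖ ≤ chartDist E wstar w := (norm_snd_le _).trans e
  exact ⟨(PiLp.norm_apply_le (w.z - wstar.z) i).trans e2,
    (PiLp.norm_apply_le (w.s - wstar.s) i).trans e3⟩

lemma abs_le_norm_tangentChart (p : M) (w : PDPoint M l m) (Δ : PDTangent E w) (i : Fin m) :
    |Δ.2.2.1 i| ≤ ‖tangentChart p w Δ‖ ∧ |Δ.2.2.2 i| ≤ ‖tangentChart p w Δ‖ := by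
  have e := (norm_snd_le _).trans (norm_snd_le (tangentChart p w Δ))
  have e2 : ‖Δ.2.2.1‖ ≤ ‖tangentChart p w Δ‖ := (norm_fst_le _).trans e
  have e3 : ‖Δ.2.2.2‖ ≤ ‖tangentChart p w Δ‖ := (norm_snd_le _).trans e
  exact ⟨(PiLp.norm_apply_le Δ.2.2.1 i).trans e2, (PiLp.norm_apply_le Δ.2.2.2 i).trans e3⟩

/-- Near `wstar`, every complementarity pair has a component bounded away from zero. -/
lemma RCOP.StandardAssumptions.eventually_pair (h : P.StandardAssumptions wstar) :
    ∃ κ > 0, ∀ᶠ w in chartNhds E wstar, ∀ i, κ ≤ w.z i ∨ κ ≤ w.s i := by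
  have hpos : ∀ i, 0 < max (wstar.z i) (wstar.s i) := fun i ↦ by
    rcases (h.g_nonpos i).eq_or_lt with hg | hg
    · exact lt_max_of_lt_left (h.strict_complementarity i hg)
    · exact lt_max_of_lt_right (by rw [h.slack]; linarith)
  obtain ⟨κ, hκ, hκ'⟩ : ∃ κ > 0, ∀ i, κ ≤ max (wstar.z i) (wstar.s i) := by
    rcases isEmpty_or_nonempty (Fin m) with hm | hm
    · exact ⟨1, one_pos, fun i ↦ hm.elim i⟩
    · obtain ⟨i₀, hi₀⟩ := Finite.exists_min fun i ↦ max (wstar.z i) (wstar.s i)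
      exact ⟨_, hpos i₀, hi₀⟩
  refine ⟨κ / 2, by positivity, ?_⟩
  filter_upwards [(tendsto_chartDist (E := E) (wstar := wstar)).eventually
    (gt_mem_nhds (half_pos hκ))] with w hw i
  obtain ⟨h1, h2⟩ := abs_sub_le_chartDist (E := E) (wstar := wstar) w i
  rcases le_max_iff.1 (hκ' i) with h3 | h3
  · left; linarith [(abs_le.1 h1).1]
  · right; linarith [(abs_le.1 h2).1]

lemma RCOP.NewtonEq.complementarity {w : PDPoint M l m} {μ : ℝ} {Δ : PDTangent E w}
    (h : P.NewtonEq w μ Δ) (i : Fin m) :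
    w.z i * Δ.2.2.2 i + w.s i * Δ.2.2.1 i = -(w.z i * w.s i) + μ := by
  have h1 := congrArg (fun ξ : PDTangent E w ↦ ξ.2.2.2 i) h
  simpa [RCOP.covDerivKKT, RCOP.kktField] using h1

/-- One step of the method near `wstar`. -/
lemma RCOP.StandardAssumptions.eventually_step (h : P.StandardAssumptions wstar)
    (hR : IsRetraction E R) :
    ∃ C > 0, ∃ r > 0, ∀ᶠ w in chartNhds E wstar, ∀ μ γ : ℝ, 0 < μ → μ < r → 0 < γ → γ ≤ 1 →
      (∀ i, 0 ≤ w.z i ∧ 0 ≤ w.s i) →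
      P.StepWellDefined w μ γ ∧ ∀ Δ : PDTangent E w, P.NewtonEq w μ Δ →
        (retract R w (stepSize w Δ γ • Δ)).x ∈ (extChartAt 𝓘(ℝ, E) wstar.x).source ∧
        chartDist E wstar (retract R w (stepSize w Δ γ • Δ)) ≤
          (1 - γ) * chartDist E wstar w + C * (chartDist E wstar w ^ 2 + μ) := by
  obtain ⟨κ, hκ, hpair⟩ := h.eventually_pair
  obtain ⟨c, hc, hnewton⟩ := h.eventually_newton
  obtain ⟨b, hb, t, ht, hretr⟩ := hR.eventually_retract wstar
  -- With D and μ below this radius, `(1 + c)(D + μ) < t`, so the step stays in the range of the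
  -- retraction estimate.
  have hr : 0 < min 1 (t / (2 * (1 + c))) := by positivity
  refine ⟨2 * b * (1 + c) ^ 2 + (1 + c) / κ + c, by positivity, _, hr, ?_⟩
  filter_upwards [hpair, hnewton, hretr, h.eventually_bijective,
    (tendsto_chartDist (E := E) (wstar := wstar)).eventually (gt_mem_nhds hr)]
    with w hpair hnewton hretr hbij hDr μ γ hμ hμr hγ hγ1 hw
  set D := chartDist E wstar w
  have hD : 0 ≤ D := chartDist_nonneg w
  have hD1 : D ≤ 1 := hDr.le.trans (min_le_left _ _)
  have hμ1 : μ ≤ 1 := hμr.le.trans (min_le_left _ _)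
  have hN : ∀ Δ : PDTangent E w, P.NewtonEq w μ Δ →
      ‖tangentChart wstar.x w Δ‖ ≤ (1 + c) * (D + μ) := by
    intro Δ hΔ
    have e1 := hnewton μ Δ hμ.le hΔ
    have e2 := norm_sub_le (w.chart E wstar.x + tangentChart wstar.x w Δ - wstar.chart E wstar.x)
      (w.chart E wstar.x - wstar.chart E wstar.x)
    rw [sub_sub_sub_cancel_right, add_sub_cancel_left] at e2
    change _ ≤ _ + D at e2
    have e3 : c * D ^ 2 ≤ c * D := by gcongr; nlinarith
    linarith
  -- `ρ` is chosen so that `κ ρ` is exactly the bound on the step length.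
  have hstep : ∀ Δ : PDTangent E w, P.NewtonEq w μ Δ → _ := fun Δ hΔ ↦
    stepSize_spec w Δ γ (ρ := (1 + c) * (D + μ) / κ) hμ hκ (by positivity) hγ hγ1
      (fun i ↦ (hw i).1) (fun i ↦ (hw i).2) hpair
      (fun i ↦ by
        rw [mul_div_cancel₀ _ hκ.ne']
        exact (abs_le_norm_tangentChart _ w Δ i).1.trans (hN Δ hΔ))
      (fun i ↦ by
        rw [mul_div_cancel₀ _ hκ.ne']
        exact (abs_le_norm_tangentChart _ w Δ i).2.trans (hN Δ hΔ))
      hΔ.complementarity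
  refine ⟨⟨hbij, fun Δ hΔ ↦ (hstep Δ hΔ).1⟩, fun Δ hΔ ↦ ?_⟩
  obtain ⟨⟨hα, hα1, -⟩, hαγ⟩ := hstep Δ hΔ
  set α := stepSize w Δ γ
  have hn := hN Δ hΔ
  have hnα : ‖tangentChart wstar.x w (α • Δ)‖ ≤ (1 + c) * (D + μ) := by
    rw [map_smul, norm_smul, Real.norm_of_nonneg hα.le]
    exact (mul_le_of_le_one_left (norm_nonneg _) hα1).trans hn
  have hlt : (1 + c) * (D + μ) < t := by
    have e1 := hDr.trans_le (min_le_right _ _)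
    have e2 := hμr.trans_le (min_le_right _ _)
    rw [lt_div_iff₀ (by positivity)] at e1 e2
    linarith
  obtain ⟨hsrc, hq⟩ := hretr (α • Δ) (hnα.trans_lt hlt)
  refine ⟨hsrc, ?_⟩
  -- Retraction error, plus a convex combination of the old error and the full Newton error with
  -- weights `1 - α` and `α`.
  have hsplit : (retract R w (α • Δ)).chart E wstar.x - wstar.chart E wstar.x =
      ((retract R w (α • Δ)).chart E wstar.x -
        (w.chart E wstar.x + tangentChart wstar.x w (α • Δ))) +
      ((1 - α) • (w.chart E wstar.x - wstar.chart E wstar.x) +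
        α • (w.chart E wstar.x + tangentChart wstar.x w Δ - wstar.chart E wstar.x)) := by
    rw [map_smul]
    module
  have e1 : ‖(1 - α) • (w.chart E wstar.x - wstar.chart E wstar.x)‖ ≤
      (1 - γ + (1 + c) * (D + μ) / κ) * D := by
    rw [norm_smul, Real.norm_of_nonneg (by linarith)]
    exact mul_le_mul_of_nonneg_right hαγ hD
  have e2 : ‖α • (w.chart E wstar.x + tangentChart wstar.x w Δ - wstar.chart E wstar.x)‖ ≤
      c * (D ^ 2 + μ) := by
    rw [norm_smul, Real.norm_of_nonneg hα.le]
    exact (mul_le_of_le_one_left (norm_nonneg _) hα1).trans (hnewton μ Δ hμ.le hΔ)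
  have e3 : b * ‖tangentChart wstar.x w (α • Δ)‖ ^ 2 ≤ 2 * b * (1 + c) ^ 2 * (D ^ 2 + μ) := by
    calc b * ‖tangentChart wstar.x w (α • Δ)‖ ^ 2 ≤ b * ((1 + c) * (D + μ)) ^ 2 := by gcongr
      _ = b * (1 + c) ^ 2 * (D + μ) ^ 2 := by ring
      _ ≤ b * (1 + c) ^ 2 * (2 * (D ^ 2 + μ)) := by
        gcongr
        nlinarith [sq_nonneg (D - μ)]
      _ = _ := by ring
  have e4 : (1 + c) * (D + μ) / κ * D ≤ (1 + c) / κ * (D ^ 2 + μ) := by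
    calc (1 + c) * (D + μ) / κ * D = (1 + c) / κ * (D ^ 2 + μ * D) := by ring
      _ ≤ _ := by
        gcongr
        exact mul_le_of_le_one_right hμ.le hD1
  have e5 := norm_add_le_of_le hq (norm_add_le_of_le e1 e2)
  rw [← hsplit] at e5
  refine e5.trans ?_
  linarith

end Step

/-! ### Induction along a run, and rates of convergence. -/

section Iteration

variable {E : Type*} [NormedAddCommGroup E] [NormedSpace ℝ E] [FiniteDimensional ℝ E]
  {M : Type*} [MetricSpace M] [ChartedSpace E M] [IsManifold 𝓘(ℝ, E) ∞ M]
  [RiemannianBundle (fun x : M ↦ TangentSpace 𝓘(ℝ, E) x)]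
  [IsContMDiffRiemannianBundle 𝓘(ℝ, E) ∞ E (fun x : M ↦ TangentSpace 𝓘(ℝ, E) x)]
  [IsRiemannianManifold 𝓘(ℝ, E) M]
  {l m : ℕ} {P : RCOP E M l m} {R : (x : M) → TangentSpace 𝓘(ℝ, E) x → M}
  {wstar : PDPoint M l m}

lemma tangentNorm_nonneg {w : PDPoint M l m} (ξ : PDTangent E w) : 0 ≤ tangentNorm ξ :=
  Real.sqrt_nonneg _

/-- The behaviour of the method started near `wstar`. -/
lemma RCOP.StandardAssumptions.exists_run_bounds (h : P.StandardAssumptions wstar)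
    (hR : IsRetraction E R) {γhat : ℝ} (hγhat : γhat ∈ Set.Ioo (0 : ℝ) 1) {θ : ℕ → ℝ → ℝ}
    (hθ : ∀ k, θ k =O[𝓝[≥] 0] fun t : ℝ ↦ t)
    (hθ' : (fun p : ℕ × ℝ ↦ θ p.1 p.2) =o[atTop ×ˢ 𝓝[≥] 0] (fun p : ℕ × ℝ ↦ p.2)) :
    ∃ C > 0, ∃ B : ℕ → ℝ, Tendsto B atTop (𝓝 0) ∧ ∃ δ > 0,
      ∀ (w : ℕ → PDPoint M l m) (μ γ : ℕ → ℝ) (n : ℕ∞),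
        P.IsRun R γhat w μ γ n → (w 0).dist wstar < δ →
        (∀ k : ℕ, k ≤ n → μ k ≤ θ k (tangentNorm (P.kktField (w k)))) →
        ∀ k : ℕ, k ≤ n → P.StepWellDefined (w k) (μ k) (γ k) ∧
          chartDist E wstar (w k) ≤ B k ∧
          tangentNorm (P.kktField (w k)) ≤ C * chartDist E wstar (w k) ∧
          ((w k).dist wstar ≤ C * chartDist E wstar (w k) ∧
            chartDist E wstar (w k) ≤ C * (w k).dist wstar) ∧
          (k < n → chartDist E wstar (w (k + 1)) ≤ (1 - γ k) * chartDist E wstar (w k) +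
            C * (chartDist E wstar (w k) ^ 2 + μ k)) := by
  obtain ⟨C₁, hC₁, r₁, hr₁, hstep⟩ := h.eventually_step hR
  obtain ⟨C₂, hC₂, hF⟩ := h.eventually_tangentNorm_le
  obtain ⟨C₃, hC₃, hdist⟩ := eventually_dist_equiv (E := E) wstar
  obtain ⟨r₂, hr₂, hnear⟩ := eventually_chartNhds_iff.1 (hstep.and (hF.and hdist))
  obtain ⟨hγ0, hγ1⟩ := hγhat
  set C := C₁ + C₂ + C₃
  have hC : 0 < C := by positivity
  -- Since `‖F‖ ≤ C D`, this `ε` makes `C μ_k ≤ (γhat / 4) D_k` for `k ≥ K`.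
  obtain ⟨K, c, hc, t₀, ht₀, hlin⟩ := exists_linear_bound hθ hθ'
    (by positivity : 0 < γhat / (4 * C ^ 2))
  -- Growth factor for the first `K` steps, where only `μ_k ≤ c C D_k` is available.
  set Λ := 1 + C + C * (c * C)
  have hΛ : 1 ≤ Λ := by
    have : 0 < C * (c * C) := by positivity
    linarith
  set q := 1 - γhat / 2
  have hq0 : 0 < q := by simp only [q]; linarith
  have hq1 : q < 1 := by simp only [q]; linarith
  -- Staying below `a` yields, in order: `D² ≤ D`, `C D² ≤ (γhat / 4) D`, validity of the barrier
  -- bounds, `μ_k < r₁`, and validity of the local estimates.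
  obtain ⟨a, ha, ha1, haγ, hat, har₁, har₂⟩ : ∃ a > 0, a ≤ 1 ∧ a ≤ γhat / (4 * C) ∧ a ≤ t₀ / C ∧
      a ≤ r₁ / (c * C) ∧ a ≤ r₂ := by
    refine ⟨min 1 (min (γhat / (4 * C)) (min (t₀ / C) (min (r₁ / (c * C)) r₂))), by positivity,
      ?_, ?_, ?_, ?_, ?_⟩ <;> simp
  have ha0 : 0 < a / Λ ^ K := by positivity
  obtain ⟨δ, hδ, hstart⟩ := exists_dist_lt_of_eventually (E := E)
    ((eventually_source_chartNhds (E := E) (wstar := wstar)).and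
      ((tendsto_chartDist (E := E) (wstar := wstar)).eventually (gt_mem_nhds ha0)))
  -- Growth by `Λ` up to index `K`, then decay by `q`; the initial factor `Λ ^ (-K)` keeps the bound
  -- below `a` throughout.
  refine ⟨C, hC, fun k ↦ Λ ^ min k K * q ^ (k - K) * (a / Λ ^ K), ?_, δ, hδ, ?_⟩
  · have h1 : Tendsto (fun k ↦ Λ ^ K * q ^ (k - K) * (a / Λ ^ K)) atTop (𝓝 0) := by
      have := (((tendsto_pow_atTop_nhds_zero_of_lt_one hq0.le hq1).comp
        (tendsto_sub_atTop_nat K)).const_mul (Λ ^ K)).mul_const (a / Λ ^ K)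
      simpa using this
    refine h1.congr' ?_
    filter_upwards [eventually_ge_atTop K] with k hk
    rw [min_eq_right hk]
  intro w μ γ n hrun hw0 hμθ
  have hBa : ∀ k, Λ ^ min k K * q ^ (k - K) * (a / Λ ^ K) ≤ a := fun k ↦ by
    have e1 : Λ ^ min k K ≤ Λ ^ K := pow_le_pow_right₀ hΛ (min_le_right _ _)
    have e2 : q ^ (k - K) ≤ 1 := pow_le_one₀ hq0.le hq1.le
    calc Λ ^ min k K * q ^ (k - K) * (a / Λ ^ K) ≤ Λ ^ K * 1 * (a / Λ ^ K) := by gcongr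
      _ = a := by field_simp
  -- the bounds at an iterate close to `wstar`
  have hone : ∀ k : ℕ, k ≤ n → (w k).x ∈ (extChartAt 𝓘(ℝ, E) wstar.x).source →
      (∀ i, 0 ≤ (w k).z i ∧ 0 ≤ (w k).s i) → chartDist E wstar (w k) < a →
      P.StepWellDefined (w k) (μ k) (γ k) ∧
      tangentNorm (P.kktField (w k)) ≤ C * chartDist E wstar (w k) ∧
      ((w k).dist wstar ≤ C * chartDist E wstar (w k) ∧
        chartDist E wstar (w k) ≤ C * (w k).dist wstar) ∧
      μ k ≤ c * (C * chartDist E wstar (w k)) ∧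
      (K ≤ k → μ k ≤ γhat / (4 * C ^ 2) * (C * chartDist E wstar (w k))) ∧
      ∀ Δ : PDTangent E (w k), P.NewtonEq (w k) (μ k) Δ →
        (retract R (w k) (stepSize (w k) Δ (γ k) • Δ)).x ∈
          (extChartAt 𝓘(ℝ, E) wstar.x).source ∧
        chartDist E wstar (retract R (w k) (stepSize (w k) Δ (γ k) • Δ)) ≤
          (1 - γ k) * chartDist E wstar (w k) + C * (chartDist E wstar (w k) ^ 2 + μ k) := by
    intro k hk hsrc hnn hD
    have hD0 := chartDist_nonneg (E := E) (wstar := wstar) (w k)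
    obtain ⟨hst, hFk, hd1, hd2⟩ := hnear (w k) hsrc (hD.trans_le har₂)
    have hdn := (w k).dist_nonneg wstar
    have hFC : tangentNorm (P.kktField (w k)) ≤ C * chartDist E wstar (w k) :=
      hFk.trans (by gcongr; simp only [C]; linarith)
    have hFt : tangentNorm (P.kktField (w k)) < t₀ := by
      have := hD.trans_le hat
      rw [lt_div_iff₀ hC] at this
      linarith
    obtain ⟨hl1, hl2⟩ := hlin k _ (tangentNorm_nonneg _) hFt
    have hμc : μ k ≤ c * (C * chartDist E wstar (w k)) :=
      ((hμθ k hk).trans hl1).trans (by gcongr)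
    have hμpos := hrun.mu_pos k hk
    have hμr : μ k < r₁ := by
      have := hD.trans_le har₁
      rw [lt_div_iff₀ (by positivity)] at this
      linarith
    have hγk := hrun.gamma_mem k hk
    obtain ⟨hwd, hnext⟩ := hst (μ k) (γ k) hμpos hμr (hγ0.trans_le hγk.1) hγk.2 hnn
    refine ⟨hwd, hFC, ⟨hd1.trans (by gcongr; simp only [C]; linarith),
      hd2.trans (by gcongr; simp only [C]; linarith)⟩, hμc,
      fun hKk ↦ ((hμθ k hk).trans (hl2 hKk)).trans (by gcongr), fun Δ hΔ ↦ ?_⟩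
    obtain ⟨h1, h2⟩ := hnext Δ hΔ
    refine ⟨h1, h2.trans ?_⟩
    gcongr
    simp only [C]; linarith
  have hinv : ∀ k : ℕ, k ≤ n → (w k).x ∈ (extChartAt 𝓘(ℝ, E) wstar.x).source ∧
      (∀ i, 0 ≤ (w k).z i ∧ 0 ≤ (w k).s i) ∧
      chartDist E wstar (w k) < Λ ^ min k K * q ^ (k - K) * (a / Λ ^ K) := by
    intro k
    induction k with
    | zero =>
      intro _
      obtain ⟨hs, hd⟩ := hstart (w 0) hw0
      exact ⟨hs, fun i ↦ ⟨(hrun.init_pos i).1.le, (hrun.init_pos i).2.le⟩, by simpa using hd⟩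
    | succ k ih =>
      intro hk
      have hkn : (k : ℕ∞) < n := lt_of_lt_of_le (by exact_mod_cast k.lt_succ_self) hk
      obtain ⟨hs, hnn, hDB⟩ := ih hkn.le
      have hDa := hDB.trans_le (hBa k)
      obtain ⟨hwd, -, -, hμc, hμε, hnext⟩ := hone k hkn.le hs hnn hDa
      obtain ⟨Δ, hΔ, hwk⟩ := hrun.step k hkn
      obtain ⟨hs', hD'⟩ := hnext Δ hΔ
      have hnn' := (hwd.2 Δ hΔ).2.2.1
      rw [← hwk] at hs' hD'
      have hz : ∀ i, 0 ≤ (w (k + 1)).z i ∧ 0 ≤ (w (k + 1)).s i := by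
        rw [hwk]; exact hnn'
      set D := chartDist E wstar (w k)
      have hD0 : 0 ≤ D := chartDist_nonneg (w k)
      have hγk := (hrun.gamma_mem k hkn.le).1
      refine ⟨hs', hz, ?_⟩
      rcases lt_or_ge k K with hkK | hkK
      · rw [min_eq_left hkK, Nat.sub_eq_zero_of_le hkK]
        rw [min_eq_left hkK.le, Nat.sub_eq_zero_of_le hkK.le] at hDB
        have e1 : chartDist E wstar (w (k + 1)) ≤ Λ * D := by
          have e2 : (1 - γ k) * D ≤ 1 * D := by gcongr; linarith
          have e3 : D ^ 2 ≤ D := by nlinarith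
          have e4 : C * (D ^ 2 + μ k) ≤ C * (D + c * (C * D)) := by gcongr
          simp only [Λ]
          linarith
        calc _ ≤ Λ * D := e1
          _ < Λ * (Λ ^ k * q ^ 0 * (a / Λ ^ K)) := by gcongr
          _ = _ := by ring
      · rw [min_eq_right (hkK.trans k.le_succ), Nat.succ_sub hkK]
        rw [min_eq_right hkK] at hDB
        -- The contraction factor is `(1 - γhat) + γhat / 4 + γhat / 4`, which is `q`.
        have e1 : chartDist E wstar (w (k + 1)) ≤ q * D := by
          have e2 : (1 - γ k) * D ≤ (1 - γhat) * D := by gcongr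
          have e3 : C * D ^ 2 ≤ γhat / 4 * D := by
            have := hDa.le.trans haγ
            rw [le_div_iff₀ (by positivity)] at this
            nlinarith
          have e4 : C * μ k ≤ γhat / 4 * D := by
            calc C * μ k ≤ C * (γhat / (4 * C ^ 2) * (C * D)) := by gcongr; exact hμε hkK
              _ = γhat / 4 * D := by field_simp
          simp only [q]
          linarith
        calc _ ≤ q * D := e1
          _ < q * (Λ ^ K * q ^ (k - K) * (a / Λ ^ K)) := by gcongr
          _ = _ := by rw [Nat.succ_eq_add_one, pow_succ]; ring
  intro k hk
  obtain ⟨hs, hnn, hDB⟩ := hinv k hk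
  obtain ⟨hwd, hF, hd, -, -, hnext⟩ := hone k hk hs hnn (hDB.trans_le (hBa k))
  refine ⟨hwd, hDB.le, hF, hd, fun hkn ↦ ?_⟩
  obtain ⟨Δ, hΔ, hwk⟩ := hrun.step k hkn
  rw [hwk]
  exact (hnext Δ hΔ).2

/-- Along iterates converging to `wstar`, the barrier rule is used in its asymptotic regime. -/
lemma tendsto_index_tangentNorm {w : ℕ → PDPoint M l m} {C : ℝ}
    (hD : Tendsto (fun k ↦ chartDist E wstar (w k)) atTop (𝓝 0))
    (hF : ∀ k, tangentNorm (P.kktField (w k)) ≤ C * chartDist E wstar (w k)) :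
    Tendsto (fun k ↦ (k, tangentNorm (P.kktField (w k)))) atTop (atTop ×ˢ 𝓝[≥] 0) := by
  refine tendsto_id.prodMk (tendsto_nhdsWithin_iff.2 ⟨?_, .of_forall fun k ↦ tangentNorm_nonneg _⟩)
  refine squeeze_zero (fun k ↦ tangentNorm_nonneg _) hF ?_
  simpa using hD.const_mul C

lemma isBigO_of_nonneg_of_le {u v : ℕ → ℝ} {C : ℝ} (hu : ∀ k, 0 ≤ u k) (h : ∀ k, u k ≤ C * v k)
    (hC : 0 ≤ C) : u =O[atTop] v :=
  .of_bound C (.of_forall fun k ↦ by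
    rw [Real.norm_of_nonneg (hu k)]
    exact (h k).trans (by gcongr; exact Real.le_norm_self _))

lemma isLittleO_succ_of_le {D ρ μ : ℕ → ℝ} {C : ℝ} (hD0 : ∀ k, 0 ≤ D k)
    (hD : Tendsto D atTop (𝓝 0)) (hρ : Tendsto ρ atTop (𝓝 0)) (hμ : μ =o[atTop] D)
    (h : ∀ k, D (k + 1) ≤ ρ k * D k + C * (D k ^ 2 + μ k)) :
    (fun k ↦ D (k + 1)) =o[atTop] D := by
  have h1 : (fun k ↦ ρ k * D k) =o[atTop] D := by
    simpa using ((isLittleO_one_iff ℝ).2 hρ).mul_isBigO (isBigO_refl D atTop)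
  have h2 : (fun k ↦ D k ^ 2) =o[atTop] D := (isLittleO_pow_id one_lt_two).comp_tendsto hD
  exact (isBigO_of_nonneg_of_le (C := 1) (fun k ↦ hD0 (k + 1)) (fun k ↦ (h k).trans_eq
    (one_mul _).symm) zero_le_one).trans_isLittleO (h1.add ((h2.add hμ).const_mul_left C))

lemma isBigO_succ_sq_of_le {D ρ μ : ℕ → ℝ} {C : ℝ} (hD0 : ∀ k, 0 ≤ D k)
    (hρ : ρ =O[atTop] D) (hμ : μ =O[atTop] fun k ↦ D k ^ 2)
    (h : ∀ k, D (k + 1) ≤ ρ k * D k + C * (D k ^ 2 + μ k)) :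
    (fun k ↦ D (k + 1)) =O[atTop] fun k ↦ D k ^ 2 := by
  have h1 : (fun k ↦ ρ k * D k) =O[atTop] fun k ↦ D k ^ 2 := by
    simpa [sq] using hρ.mul (isBigO_refl D atTop)
  exact (isBigO_of_nonneg_of_le (C := 1) (fun k ↦ hD0 (k + 1)) (fun k ↦ (h k).trans_eq
    (one_mul _).symm) zero_le_one).trans (h1.add (((isBigO_refl _ _).add hμ).const_mul_left C))

/-- The rate of convergence can be measured in the chart. -/
lemma dist_isBigO_chartDist {w : ℕ → PDPoint M l m} {C : ℝ} (hC : 0 ≤ C)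
    (h : ∀ k, (w k).dist wstar ≤ C * chartDist E wstar (w k) ∧
      chartDist E wstar (w k) ≤ C * (w k).dist wstar) :
    (fun k ↦ (w k).dist wstar) =O[atTop] (fun k ↦ chartDist E wstar (w k)) ∧
      (fun k ↦ chartDist E wstar (w k)) =O[atTop] fun k ↦ (w k).dist wstar :=
  ⟨isBigO_of_nonneg_of_le (fun k ↦ (w k).dist_nonneg _) (fun k ↦ (h k).1) hC,
    isBigO_of_nonneg_of_le (fun k ↦ chartDist_nonneg (w k)) (fun k ↦ (h k).2) hC⟩

lemma convergesSuperlinearly_of_chartDist {w : ℕ → PDPoint M l m} {C : ℝ} (hC : 0 ≤ C)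
    (h : ∀ k, (w k).dist wstar ≤ C * chartDist E wstar (w k) ∧
      chartDist E wstar (w k) ≤ C * (w k).dist wstar)
    (hD : Tendsto (fun k ↦ chartDist E wstar (w k)) atTop (𝓝 0))
    (ho : (fun k ↦ chartDist E wstar (w (k + 1))) =o[atTop] fun k ↦ chartDist E wstar (w k)) :
    ConvergesSuperlinearly w wstar := by
  obtain ⟨h1, h2⟩ := dist_isBigO_chartDist hC h
  exact ⟨h1.trans_tendsto hD,
    ((h1.comp_tendsto (tendsto_add_atTop_nat 1)).trans_isLittleO ho).trans_isBigO h2⟩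

lemma convergesQuadratically_of_chartDist {w : ℕ → PDPoint M l m} {C : ℝ} (hC : 0 ≤ C)
    (h : ∀ k, (w k).dist wstar ≤ C * chartDist E wstar (w k) ∧
      chartDist E wstar (w k) ≤ C * (w k).dist wstar)
    (hD : Tendsto (fun k ↦ chartDist E wstar (w k)) atTop (𝓝 0))
    (ho : (fun k ↦ chartDist E wstar (w (k + 1))) =O[atTop]
      fun k ↦ chartDist E wstar (w k) ^ 2) :
    ConvergesQuadratically w wstar := by
  obtain ⟨h1, h2⟩ := dist_isBigO_chartDist hC h
  exact ⟨h1.trans_tendsto hD,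
    ((h1.comp_tendsto (tendsto_add_atTop_nat 1)).trans ho).trans (h2.pow 2)⟩

end Iteration

end RIPM

end

theorem theorem5p1
    {E : Type*} [NormedAddCommGroup E] [NormedSpace ℝ E] [FiniteDimensional ℝ E]
    {M : Type*} [MetricSpace M] [ChartedSpace E M] [IsManifold 𝓘(ℝ, E) ∞ M]
    [RiemannianBundle (fun x : M ↦ TangentSpace 𝓘(ℝ, E) x)]
    [IsContMDiffRiemannianBundle 𝓘(ℝ, E) ∞ E (fun x : M ↦ TangentSpace 𝓘(ℝ, E) x)]
    [IsRiemannianManifold 𝓘(ℝ, E) M] [ConnectedSpace M] [CompleteSpace M]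
    {l m : ℕ} (P : RIPM.RCOP E M l m)
    (R : (x : M) → TangentSpace 𝓘(ℝ, E) x → M) (hR : RIPM.IsRetraction E R)
    (γhat : ℝ) (hγhat : γhat ∈ Set.Ioo (0 : ℝ) 1)
    (wstar : RIPM.PDPoint M l m) (hstar : P.StandardAssumptions wstar)
    -- the rule `μ_k ≤ θ_k(‖F(w_k)‖)` by which the barrier parameters are chosen
    (θ : ℕ → ℝ → ℝ) (hθ : ∀ k, θ k =O[𝓝[≥] 0] fun t : ℝ ↦ t) :
    -- (1) superlinear convergence: `θ_k(t) = o(t)` as `k → ∞`, `t → 0`, and `γ_k → 1`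
    ((fun p : ℕ × ℝ ↦ θ p.1 p.2) =o[atTop ×ˢ 𝓝[≥] 0] (fun p : ℕ × ℝ ↦ p.2) →
      ∃ δ > 0,
        (∀ (w : ℕ → RIPM.PDPoint M l m) (μ γ : ℕ → ℝ) (n : ℕ),
          P.IsRun R γhat w μ γ n → (w 0).dist wstar < δ →
          (∀ k ≤ n, μ k ≤ θ k (RIPM.tangentNorm (P.kktField (w k)))) →
          P.StepWellDefined (w n) (μ n) (γ n)) ∧
        (∀ (w : ℕ → RIPM.PDPoint M l m) (μ γ : ℕ → ℝ),
          P.IsRun R γhat w μ γ ⊤ → (w 0).dist wstar < δ →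
          (∀ k, μ k ≤ θ k (RIPM.tangentNorm (P.kktField (w k)))) →
          Tendsto γ atTop (𝓝 1) →
          RIPM.ConvergesSuperlinearly w wstar)) ∧
    -- (2) quadratic convergence: `θ_k(t) = O(t²)` as `k → ∞`, `t → 0`, and `1 - γ_k = O(‖F(w_k)‖)`
    ((fun p : ℕ × ℝ ↦ θ p.1 p.2) =O[atTop ×ˢ 𝓝[≥] 0] (fun p : ℕ × ℝ ↦ p.2 ^ 2) →
      ∃ δ > 0,
        (∀ (w : ℕ → RIPM.PDPoint M l m) (μ γ : ℕ → ℝ) (n : ℕ),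
          P.IsRun R γhat w μ γ n → (w 0).dist wstar < δ →
          (∀ k ≤ n, μ k ≤ θ k (RIPM.tangentNorm (P.kktField (w k)))) →
          P.StepWellDefined (w n) (μ n) (γ n)) ∧
        (∀ (w : ℕ → RIPM.PDPoint M l m) (μ γ : ℕ → ℝ),
          P.IsRun R γhat w μ γ ⊤ → (w 0).dist wstar < δ →
          (∀ k, μ k ≤ θ k (RIPM.tangentNorm (P.kktField (w k)))) →
          (fun k ↦ 1 - γ k) =O[atTop] (fun k ↦ RIPM.tangentNorm (P.kktField (w k))) →
          RIPM.ConvergesQuadratically w wstar)) := by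
  refine ⟨fun hlittle ↦ ?_, fun hbig ↦ ?_⟩
  · obtain ⟨C, hC, B, hB, δ, hδ, hrun⟩ := hstar.exists_run_bounds hR hγhat hθ hlittle
    refine ⟨δ, hδ, fun w μ γ n hw h0 hμ ↦ ?_, fun w μ γ hw h0 hμ hγ ↦ ?_⟩
    · exact (hrun w μ γ n hw h0 (fun k hk ↦ hμ k (by exact_mod_cast hk)) n le_rfl).1
    · have hall := fun k : ℕ ↦ hrun w μ γ ⊤ hw h0 (fun k _ ↦ hμ k) k le_top
      have hD := squeeze_zero (fun k ↦ RIPM.chartDist_nonneg (w k)) (fun k ↦ (hall k).2.1) hB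
      have hF := fun k ↦ (hall k).2.2.1
      have hFO := RIPM.isBigO_of_nonneg_of_le (fun k ↦ RIPM.tangentNorm_nonneg _) hF hC.le
      -- Convergence is already known, so the joint limit of the rule can be taken along the pairs
      -- `(k, ‖F(w_k)‖)`; with `‖F(w_k)‖ = O(D_k)` this gives `μ_k = o(D_k)`.
      have hμo := (RIPM.isBigO_of_nonneg_of_le (C := 1) (fun k ↦ (hw.mu_pos k le_top).le)
        (fun k ↦ (hμ k).trans_eq (one_mul _).symm) zero_le_one).trans_isLittleO
          (hlittle.comp_tendsto (RIPM.tendsto_index_tangentNorm hD hF))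
      refine RIPM.convergesSuperlinearly_of_chartDist hC.le (fun k ↦ (hall k).2.2.2.1) hD
        (RIPM.isLittleO_succ_of_le (ρ := fun k ↦ 1 - γ k) (fun k ↦ RIPM.chartDist_nonneg (w k)) hD
          ?_ (hμo.trans_isBigO hFO) fun k ↦ (hall k).2.2.2.2 (ENat.natCast_lt_top k))
      simpa using hγ.const_sub 1
  · obtain ⟨C, hC, B, hB, δ, hδ, hrun⟩ :=
      hstar.exists_run_bounds hR hγhat hθ (RIPM.isLittleO_of_isBigO_sq hbig)
    refine ⟨δ, hδ, fun w μ γ n hw h0 hμ ↦ ?_, fun w μ γ hw h0 hμ hγ ↦ ?_⟩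
    · exact (hrun w μ γ n hw h0 (fun k hk ↦ hμ k (by exact_mod_cast hk)) n le_rfl).1
    · have hall := fun k : ℕ ↦ hrun w μ γ ⊤ hw h0 (fun k _ ↦ hμ k) k le_top
      have hD := squeeze_zero (fun k ↦ RIPM.chartDist_nonneg (w k)) (fun k ↦ (hall k).2.1) hB
      have hF := fun k ↦ (hall k).2.2.1
      have hFO := RIPM.isBigO_of_nonneg_of_le (fun k ↦ RIPM.tangentNorm_nonneg _) hF hC.le
      have hμO := (RIPM.isBigO_of_nonneg_of_le (C := 1) (fun k ↦ (hw.mu_pos k le_top).le)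
        (fun k ↦ (hμ k).trans_eq (one_mul _).symm) zero_le_one).trans
          (hbig.comp_tendsto (RIPM.tendsto_index_tangentNorm hD hF))
      exact RIPM.convergesQuadratically_of_chartDist hC.le (fun k ↦ (hall k).2.2.2.1) hD
        (RIPM.isBigO_succ_sq_of_le (fun k ↦ RIPM.chartDist_nonneg (w k))
          (hγ.trans hFO) (hμO.trans (hFO.pow 2)) fun k ↦ (hall k).2.2.2.2 (ENat.natCast_lt_top k))
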